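/- Let $m\ge 1$ and let $d_1<d_2<\dots<d_m$ be positive integers with $\gcd(d_1,\dots,d_m)=1$, none of which is a combination of the others with nonnegative integer coefficients. Let $S=\{\sum_i x_id_i : x_i\in\mathbb{Z}_{\ge 0}\}$ be the numerical semigroup that they minimally generate, and let $\Sigma=d_1+\dots+d_m$. Let $c$ be the conductor of $S$ (the least $s\in S$ with $s+\mathbb{Z}_{\ge 0}\subseteq S$) and $F=c-1$ its Frobenius number. Put $$S'=\{x\in\mathbb{Z}\setminus S : x+s\in S \text{ for all } s\in S\setminus\{0\}\},\qquad \Delta_{\mathcal H}=\{h\in\mathbb{Z}\setminus S : F-h\notin S\}.$$ Assume that $S$ is almost symmetric, that is, $S'\setminus\{F\}=\Delta_{\mathcal H}$, and of maximal embedding dimension, that is, $d_1=m$. Multisets of integers are joined by adding multiplicities, intersected by taking the minimum of the multiplicities, and their cardinality counts multiplicities. For $1\le i\le m-1$ let $\mathfrak L_i$ be the multiset of all sums $d_{j_1}+\dots+d_{j_i}+h$ with $j_1<\dots<j_i$ and $h\in\Delta_{\mathcal H}$ (one element for each choice of $j_1,\dots,j_i,h$). Let $\mathfrak M_1$ be the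 join of the $\mathfrak L_i$ with $i$ odd, $\mathfrak M_2$ the join of the $\mathfrak L_i$ with $i$ even, $1\le i\le m-1$, and let $\ell$ be the cardinality of $\mathfrak M_1\cap\mathfrak M_2$. Let $k$ be a field of characteristic $0$ and let $R=k[X_1,\dots,X_m]$ be graded by $\deg X_j=d_j$. Let $C_{1,i},\dots,C_{\beta_i,i}$ be the degrees of the basis elements of the $i$-th free module in a minimal graded free resolution over $R$ of the semigroup ring $k[z^{d_1},\dots,z^{d_m}]$, an $R$-module via $X_j\mapsto z^{d_j}$. Let $\mathfrak B_i$ be the multiset of the $C_{j,i}$ and $\overline{\mathfrak B}_i$ the multiset of the $F+\Sigma-C_{j,i}$, $1\le j\le\beta_i$. Let $\mathfrak B_o,\overline{\mathfrak B}_o$ be the joins of the $\mathfrak B_i$, respectively the $\overline{\mathfrak B}_i$, with $i$ odd and $1\le i\le m-2$, and $\mathfrak B_e,\overline{\mathfrak B}_e$ those with $i$ even and $1\le i\le m-2$. Let $\mathfrak X_1$ be the join of $\mathfrak B_o$ and $\overline{\mathfrak B}_o$ and $\mathfrak X_2$ the join of $\mathfrak B_e$ and $\overline{\mathfrak B}_e$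 if $m$ is even; let $\mathfrak X_1$ be the join of $\mathfrak B_o$ and $\overline{\mathfrak B}_e$ and $\mathfrak X_2$ the join of $\mathfrak B_e$ and $\overline{\mathfrak B}_o$ if $m$ is odd. Let $\rho$ be the cardinality of $\mathfrak X_1\cap\mathfrak X_2$. Then $\rho=\ell$, that is, $\delta:=\rho-\ell=0$. -/

import Mathlib

namespace NumSemigroup

/-- `d 0 < d 1 < ⋯ < d (m-1)` is the minimal generating set of a numerical semigroup: positive
integers with greatest common divisor `1`, none of which is a combination of the others with
nonnegative integer coefficients. -/
structure IsMinimalGenerators {m : ℕ} (d : Fin m → ℕ) : Prop where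
  strictMono : StrictMono d
  pos : ∀ i, 0 < d i
  gcd_eq_one : Finset.univ.gcd d = 1
  minimal : ∀ i, d i ∉ AddSubmonoid.closure (d '' {i}ᶜ)

/-- The semigroup generated by `d`. -/
def semigroup {m : ℕ} (d : Fin m → ℕ) : AddSubmonoid ℕ :=
  AddSubmonoid.closure (Set.range d)

/-- The conductor: the least `s ∈ S` with `s + n ∈ S` for all `n ≥ 0`. -/
noncomputable def conductor (S : AddSubmonoid ℕ) : ℕ :=
  sInf {s : ℕ | s ∈ S ∧ ∀ n : ℕ, s + n ∈ S}

/-- The Frobenius number, as an integer (it is `-1` for `S = ℕ`). -/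
noncomputable def frobenius (S : AddSubmonoid ℕ) : ℤ := (conductor S : ℤ) - 1

/-- `S` as a subset of `ℤ`. -/
def intSet (S : AddSubmonoid ℕ) : Set ℤ := {x : ℤ | ∃ s ∈ S, (s : ℤ) = x}

/-- The set `S'` of pseudo-Frobenius numbers; its cardinality is the type of `S`. -/
def pseudoFrobenius (S : AddSubmonoid ℕ) : Set ℤ :=
  {x : ℤ | x ∉ intSet S ∧ ∀ s ∈ S, s ≠ 0 → x + (s : ℤ) ∈ intSet S}

/-- The set `Δ_H` of the `h ∉ S` with `F - h ∉ S`. -/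
def gapsH (S : AddSubmonoid ℕ) : Set ℤ :=
  {h : ℤ | h ∉ intSet S ∧ frobenius S - h ∉ intSet S}

/-- Almost symmetric: `S' \ {F} = Δ_H`. -/
def IsAlmostSymmetric (S : AddSubmonoid ℕ) : Prop :=
  pseudoFrobenius S \ {frobenius S} = gapsH S

open Classical in
/-- `Δ_H` as a finite set (see `mem_gapsHFinset`). -/
noncomputable def gapsHFinset (S : AddSubmonoid ℕ) : Finset ℤ :=
  (Finset.Icc 0 (frobenius S)).filter (fun h => h ∈ gapsH S)

/-- A submonoid of `ℕ` generated by numbers with greatest common divisor `1` has a conductor. -/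
theorem exists_conductor {m : ℕ} {d : Fin m → ℕ} (hd : Finset.univ.gcd d = 1) :
    ∃ s : ℕ, s ∈ semigroup d ∧ ∀ n : ℕ, s + n ∈ semigroup d := by
  have h1 : Nat.setGcd (Set.range d) = 1 := by
    apply Nat.dvd_one.mp
    rw [← hd]
    apply Finset.dvd_gcd
    intro i _
    exact Nat.setGcd_dvd_of_mem (Set.mem_range_self i)
  obtain ⟨n, hn⟩ := Nat.exists_mem_closure_of_ge (Set.range d)
  refine ⟨n, hn n le_rfl (by rw [h1]; exact one_dvd _), fun k => ?_⟩
  exact hn (n + k) (Nat.le_add_right n k) (by rw [h1]; exact one_dvd _)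

/-- The finite set `gapsHFinset` has exactly the elements of `Δ_H`. -/
theorem mem_gapsHFinset {m : ℕ} {d : Fin m → ℕ} (hd : Finset.univ.gcd d = 1) (h : ℤ) :
    h ∈ gapsHFinset (semigroup d) ↔ h ∈ gapsH (semigroup d) := by
  have key : ∀ x : ℤ, frobenius (semigroup d) < x → x ∈ intSet (semigroup d) := by
    intro x hx
    have hc := Nat.sInf_mem (s := {s : ℕ | s ∈ semigroup d ∧ ∀ n : ℕ, s + n ∈ semigroup d})
      (exists_conductor hd)
    have hx' : (conductor (semigroup d) : ℤ) ≤ x := by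
      unfold frobenius at hx
      omega
    refine ⟨conductor (semigroup d) + (x - conductor (semigroup d)).toNat, hc.2 _, ?_⟩
    push_cast
    omega
  simp only [gapsHFinset, Finset.mem_filter, Finset.mem_Icc, and_iff_right_iff_imp]
  rintro ⟨h1, h2⟩
  refine ⟨?_, ?_⟩
  · by_contra hneg
    exact h2 (key _ (by omega))
  · by_contra hbig
    exact h1 (key _ (by omega))

/-! Multisets of integers: the join is `+`, the intersection (minimum of multiplicities) is `∩`,
and the cardinality counts elements with multiplicity. -/

/-- The join sumset: all sums `a + b`, with the product of the multiplicities. -/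
def joinSumset (A B : Multiset ℤ) : Multiset ℤ := (A ×ˢ B).map (fun p => p.1 + p.2)

/-- The multiset `D_i` of the sums of `i` generators with distinct indices. -/
def genSums {m : ℕ} (d : Fin m → ℕ) (i : ℕ) : Multiset ℤ :=
  (Finset.powersetCard i (Finset.univ : Finset (Fin m))).val.map (fun J => ∑ j ∈ J, (d j : ℤ))

/-- The multiset `L_i`, the join sumset of `D_i` and `Δ_H`. -/
noncomputable def multL {m : ℕ} (d : Fin m → ℕ) (i : ℕ) : Multiset ℤ :=
  joinSumset (genSums d i) (gapsHFinset (semigroup d)).val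

/-- The multiset `M_1 = L_o`, the join of the `L_i` with `1 ≤ i ≤ m - 1` odd. -/
noncomputable def multM₁ {m : ℕ} (d : Fin m → ℕ) : Multiset ℤ :=
  ∑ i ∈ (Finset.Ico 1 m).filter (fun i => Odd i), multL d i

/-- The multiset `M_2 = L_e`, the join of the `L_i` with `1 ≤ i ≤ m - 1` even. -/
noncomputable def multM₂ {m : ℕ} (d : Fin m → ℕ) : Multiset ℤ :=
  ∑ i ∈ (Finset.Ico 1 m).filter (fun i => Even i), multL d i

/-- `ℓ`, the cardinality of the intersection of `M_1` and `M_2`. -/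
noncomputable def ell {m : ℕ} (d : Fin m → ℕ) : ℕ := (multM₁ d ∩ multM₂ d).card

/-- The kernel of `k[X_1, …, X_m] → k[z]`, `X_i ↦ z ^ d_i`, so that `k[X_1, …, X_m]` modulo it is
the semigroup ring `k[z^{d_1}, …, z^{d_m}]`. -/
noncomputable def semigroupIdeal (k : Type*) [Field k] {m : ℕ} (d : Fin m → ℕ) :
    Ideal (MvPolynomial (Fin m) k) :=
  RingHom.ker (MvPolynomial.aeval (R := k) (fun i => (Polynomial.X ^ d i : Polynomial k)))

/-- A minimal graded free resolution `⋯ → F_2 → F_1 → F_0 → R/I → 0` of `R/I`, where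
`R = k[X_1, …, X_m]` is graded by `deg X_i = d_i`. Here `F_i` is free of finite rank `rank i`, its
`j`-th basis vector is homogeneous of degree `deg i j`, the maps are homogeneous of degree `0`,
and the image of `F_{i+1}` lies in `(X_1, …, X_m) F_i`. -/
structure MinimalResolution (k : Type*) [Field k] {m : ℕ} (d : Fin m → ℕ)
    (I : Ideal (MvPolynomial (Fin m) k)) where
  /-- the Betti numbers `β_i` -/
  rank : ℕ → ℕ
  /-- the degrees `C_{j,i}` of the syzygies of the `i`-th kind -/
  deg : (i : ℕ) → Fin (rank i) → ℕ
  /-- the map from `F_0` onto `R/I` -/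
  aug : (Fin (rank 0) → MvPolynomial (Fin m) k) →ₗ[MvPolynomial (Fin m) k]
    (MvPolynomial (Fin m) k ⧸ I)
  /-- the maps from `F_{i+1}` to `F_i` -/
  diff : (i : ℕ) → (Fin (rank (i + 1)) → MvPolynomial (Fin m) k) →ₗ[MvPolynomial (Fin m) k]
    (Fin (rank i) → MvPolynomial (Fin m) k)
  aug_surjective : Function.Surjective aug
  exact_zero : Function.Exact (diff 0) aug
  exact_succ : ∀ i, Function.Exact (diff (i + 1)) (diff i)
  aug_homogeneous : ∀ j, ∃ p : MvPolynomial (Fin m) k,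
    MvPolynomial.IsWeightedHomogeneous d p (deg 0 j) ∧
      aug (Pi.single j 1) = Ideal.Quotient.mk I p
  diff_homogeneous : ∀ i j l (e : Fin m →₀ ℕ),
    MvPolynomial.coeff e (diff i (Pi.single j 1) l) ≠ 0 →
      Finsupp.weight d e + deg i l = deg (i + 1) j
  minimal : ∀ i v l, MvPolynomial.constantCoeff (diff i v l) = 0

namespace MinimalResolution

variable {k : Type*} [Field k] {m : ℕ} {d : Fin m → ℕ} {I : Ideal (MvPolynomial (Fin m) k)}

/-- The multiset `B_i` of the syzygy degrees `C_{j,i}`. -/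
def multB (P : MinimalResolution k d I) (i : ℕ) : Multiset ℤ :=
  Finset.univ.val.map (fun j : Fin (P.rank i) => (P.deg i j : ℤ))

/-- The multiset of the conjugate degrees `F + Σ_m - C_{j,i}`. -/
noncomputable def multBbar (P : MinimalResolution k d I) (i : ℕ) : Multiset ℤ :=
  (P.multB i).map (fun c => frobenius (semigroup d) + ∑ j, (d j : ℤ) - c)

/-- `B_o`: the join of the `B_i` with `1 ≤ i ≤ m - 2` odd. -/
def multBo (P : MinimalResolution k d I) : Multiset ℤ :=
  ∑ i ∈ (Finset.Ico 1 (m - 1)).filter (fun i => Odd i), P.multB i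

/-- `B_e`: the join of the `B_i` with `1 ≤ i ≤ m - 2` even. -/
def multBe (P : MinimalResolution k d I) : Multiset ℤ :=
  ∑ i ∈ (Finset.Ico 1 (m - 1)).filter (fun i => Even i), P.multB i

/-- The conjugate of `B_o`. -/
noncomputable def multBoBar (P : MinimalResolution k d I) : Multiset ℤ :=
  ∑ i ∈ (Finset.Ico 1 (m - 1)).filter (fun i => Odd i), P.multBbar i

/-- The conjugate of `B_e`. -/
noncomputable def multBeBar (P : MinimalResolution k d I) : Multiset ℤ :=
  ∑ i ∈ (Finset.Ico 1 (m - 1)).filter (fun i => Even i), P.multBbar i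

/-- The multiset `X_1`. -/
noncomputable def multX₁ (P : MinimalResolution k d I) : Multiset ℤ :=
  if Even m then P.multBo + P.multBoBar else P.multBo + P.multBeBar

/-- The multiset `X_2`. -/
noncomputable def multX₂ (P : MinimalResolution k d I) : Multiset ℤ :=
  if Even m then P.multBe + P.multBeBar else P.multBe + P.multBoBar

/-- `ρ`, the cardinality of the intersection of `X_1` and `X_2`. -/
noncomputable def rho (P : MinimalResolution k d I) : ℕ := (P.multX₁ ∩ P.multX₂).card

end MinimalResolution

end NumSemigroup

/-! Since `d 0 = m`, the Apéry set of S with respect to m is {0} together with the generators other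
than m. This fixes every multiset in the problem.

Syzygy degrees. By dimension shifting along the resolution, the number of basis elements of degree n
in the i-th free module (i ≥ 1) is the dimension of the Koszul homology of the semigroup ring in
bidegree (i, n). Multiplication by z^m is injective on that ring, so a Koszul cycle is determined by
its coefficients at index sets omitting 0, and the Apéry set tells which coefficients are free. If
E_i denotes the multiset of sums of i distinct generators other than m, counting dimensions gives
B_i + E_(i+1) = E_i ⊕ E_1 for i ≥ 1, where ⊕ is the join sumset (`multB_add_tailSums`).

Multiset identity. Let E be the product of the 1 - T^(d_j) over j ≠ 0, w the generating function of
E_1, s' the sum of the d_j with j ≠ 0, and ε = (-1)^(m-1). The relation above sums to K = Σ (-1)^i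
B_i = E w + E - 1 - ε T^(s') w. The pseudo-Frobenius numbers are the d_i - m with i ≠ 0, the largest
being F = d_l - m with l the last index, so almost symmetry gives w = T^m D + T^(d_l), with D the
generating function of Δ_H. Inverting T multiplies E by ε T^(-s'), and D is fixed by h ↦ F - h.
Hence K - ε T^(d_l + s') K(1/T), which is X_2 - X_1, equals M_1 - M_2, that is, X_1 + M_1 = X_2 +
M_2 (`multX_add_multM`).

Cardinalities. Both |X_1| + |X_2| and |M_1| + |M_2| equal (2^m - 2)(m - 2). Together with the
identity this forces |X_1 ∩ X_2| = |M_1 ∩ M_2| (`card_inter_eq_card_inter`). -/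

namespace NumSemigroup

/-! ### Koszul complexes of commuting operators on a graded vector space. -/

section Koszul

variable {k N N' : Type*} [Field k] [AddCommGroup N] [Module k N] [AddCommGroup N'] [Module k N']
  {m : ℕ}

/-- The rank-nullity formula for the restriction of a linear map to a subspace. -/
theorem finrank_map_add_finrank_inf_ker (f : N →ₗ[k] N') (G : Submodule k N)
    [FiniteDimensional k G] :
    Module.finrank k (G.map f) + Module.finrank k (G ⊓ LinearMap.ker f : Submodule k N) =
      Module.finrank k G := by
  have h := LinearMap.finrank_range_add_finrank_ker (f.domRestrict G)
  have h1 : LinearMap.range (f.domRestrict G) = G.map f := by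
    rw [LinearMap.domRestrict, LinearMap.range_comp, Submodule.range_subtype]
  have h2 : (LinearMap.ker (f.domRestrict G)).map G.subtype = G ⊓ LinearMap.ker f := by
    ext y
    simp only [Submodule.mem_map, LinearMap.mem_ker, Submodule.mem_inf]
    constructor
    · rintro ⟨z, hz, rfl⟩
      exact ⟨z.2, hz⟩
    · rintro ⟨hy, hz⟩
      exact ⟨⟨y, hy⟩, hz, rfl⟩
  rw [h1, LinearEquiv.finrank_eq (Submodule.equivMapOfInjective G.subtype
    G.injective_subtype (LinearMap.ker (f.domRestrict G))), h2] at h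
  exact h

/-- The sign of `j` in `J ∪ {j}`. -/
def koszulSign (j : Fin m) (J : Finset (Fin m)) : ℤ := (-1) ^ (J.filter (· < j)).card

/-- Of two distinct indices, only the smaller one changes the sign of the other when it is inserted
first. This is the cancellation behind ∂² = 0. -/
theorem koszulSign_anticomm {i j : Fin m} {J : Finset (Fin m)} (hij : i ≠ j) (hi : i ∉ J)
    (hj : j ∉ J) :
    koszulSign j J * koszulSign i (insert j J) + koszulSign i J * koszulSign j (insert i J) =
      0 := by
  simp only [koszulSign, Finset.filter_insert]
  rcases lt_or_gt_of_ne hij with h | h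
  · rw [if_neg (not_lt.mpr h.le), if_pos h, Finset.card_insert_of_notMem (by simp [hi])]
    ring
  · rw [if_neg (not_lt.mpr h.le), if_pos h, Finset.card_insert_of_notMem (by simp [hj])]
    ring

theorem koszulSign_mul_self (j : Fin m) (J : Finset (Fin m)) :
    koszulSign j J * koszulSign j J = 1 := by
  simp [koszulSign, ← mul_pow]

/-- The differential of the Koszul complex of the operators `x j` on `N`, whose elements are
written as functions on the set of subsets of `Fin m`. -/
def koszul (x : Fin m → N →ₗ[k] N) : (Finset (Fin m) → N) →ₗ[k] (Finset (Fin m) → N) :=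
  LinearMap.pi fun J => ∑ j ∈ Jᶜ, koszulSign j J • (x j ∘ₗ LinearMap.proj (insert j J))

theorem koszul_apply (x : Fin m → N →ₗ[k] N) (f : Finset (Fin m) → N) (J : Finset (Fin m)) :
    koszul x f J = ∑ j ∈ Jᶜ, koszulSign j J • x j (f (insert j J)) := by
  simp [koszul]

/-- The terms of ∂² are indexed by ordered pairs of indices outside J; swapping the pair is a
fixed-point-free involution whose orbits cancel by `koszulSign_anticomm`. -/
theorem koszul_koszul {x : Fin m → N →ₗ[k] N} (hx : ∀ i j v, x i (x j v) = x j (x i v))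
    (f : Finset (Fin m) → N) : koszul x (koszul x f) = 0 := by
  funext J
  simp only [koszul_apply, Pi.zero_apply, map_sum, map_zsmul, Finset.smul_sum, smul_smul]
  rw [Finset.sum_sigma']
  refine Finset.sum_involution (fun p _ => ⟨p.2, p.1⟩) ?_ ?_ ?_ ?_
  · rintro ⟨j, i⟩ h
    simp only [Finset.mem_sigma, Finset.mem_compl, Finset.mem_insert, not_or] at h
    simp only [hx i j, Finset.insert_comm i j]
    rw [← add_smul, koszulSign_anticomm h.2.1 h.2.2 h.1, zero_smul]
  · rintro ⟨j, i⟩ h _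
    simp only [Finset.mem_sigma, Finset.mem_compl, Finset.mem_insert, not_or] at h
    intro heq
    exact h.2.1 (congrArg Sigma.fst heq)
  · rintro ⟨j, i⟩ h
    simp only [Finset.mem_sigma, Finset.mem_compl, Finset.mem_insert, not_or] at h ⊢
    exact ⟨h.2.2, Ne.symm h.2.1, h.1⟩
  · rintro ⟨j, i⟩ _
    rfl

theorem koszul_naturality {x : Fin m → N →ₗ[k] N} {x' : Fin m → N' →ₗ[k] N'} {φ : N →ₗ[k] N'}
    (hφ : ∀ i v, φ (x i v) = x' i (φ v)) (f : Finset (Fin m) → N) :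
    φ.compLeft _ (koszul x f) = koszul x' (φ.compLeft _ f) := by
  funext J
  simp [koszul_apply, hφ]

/-- The part of degree `n` and homological degree `j` of the Koszul complex, for a graded space
with graded pieces `A i` and operators of degrees `d i`. -/
def koszulStrand (d : Fin m → ℕ) (A : ℤ → Submodule k N) (j : ℕ) (n : ℤ) :
    Submodule k (Finset (Fin m) → N) :=
  Submodule.pi Set.univ fun J => if J.card = j then A (n - ∑ i ∈ J, (d i : ℤ)) else ⊥

theorem mem_koszulStrand {d : Fin m → ℕ} {A : ℤ → Submodule k N} {j : ℕ} {n : ℤ}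
    {f : Finset (Fin m) → N} : f ∈ koszulStrand d A j n ↔
      (∀ J, J.card = j → f J ∈ A (n - ∑ i ∈ J, (d i : ℤ))) ∧ ∀ J, J.card ≠ j → f J = 0 := by
  simp only [koszulStrand, Submodule.mem_pi, Set.mem_univ, forall_true_left]
  constructor
  · intro h
    refine ⟨fun J hJ => by simpa [hJ] using h J, fun J hJ => by simpa [hJ] using h J⟩
  · rintro ⟨h1, h2⟩ J
    by_cases hJ : J.card = j
    · simpa [hJ] using h1 J hJ
    · simpa [hJ] using h2 J hJ

instance finiteDimensional_koszulStrand (d : Fin m → ℕ) (A : ℤ → Submodule k N)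
    [∀ n, FiniteDimensional k (A n)] (j : ℕ) (n : ℤ) :
    FiniteDimensional k (koszulStrand d A j n) := by
  have : ∀ J : Finset (Fin m), FiniteDimensional k
      (if J.card = j then A (n - ∑ i ∈ J, (d i : ℤ)) else ⊥ : Submodule k N) := by
    intro J
    by_cases hJ : J.card = j
    · rw [if_pos hJ]
      infer_instance
    · rw [if_neg hJ]
      infer_instance
  let g : koszulStrand d A j n →ₗ[k] ∀ J : Finset (Fin m),
      (if J.card = j then A (n - ∑ i ∈ J, (d i : ℤ)) else ⊥ : Submodule k N) :=
    { toFun := fun f J => ⟨f.1 J, f.2 J (Set.mem_univ _)⟩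
      map_add' := fun _ _ => rfl
      map_smul' := fun _ _ => rfl }
  refine FiniteDimensional.of_injective g fun f f' h => ?_
  ext J
  exact congrArg Subtype.val (congrFun h J)

/-- The operators `x i` have degree `d i` for the grading by the `A n`. -/
def IsGradedAction (d : Fin m → ℕ) (x : Fin m → N →ₗ[k] N) (A : ℤ → Submodule k N) : Prop :=
  ∀ i n, ∀ v ∈ A n, x i v ∈ A (n + d i)

theorem IsGradedAction.koszul_mem {d : Fin m → ℕ} {x : Fin m → N →ₗ[k] N}
    {A : ℤ → Submodule k N} (h : IsGradedAction d x A) {j : ℕ} {n : ℤ}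
    {f : Finset (Fin m) → N} (hf : f ∈ koszulStrand d A (j + 1) n) :
    koszul x f ∈ koszulStrand d A j n := by
  rw [mem_koszulStrand] at hf ⊢
  constructor
  · intro J hJ
    rw [koszul_apply]
    refine Submodule.sum_mem _ fun i hi => zsmul_mem ?_ _
    rw [Finset.mem_compl] at hi
    have h1 := h i _ _ (hf.1 (insert i J) (by rw [Finset.card_insert_of_notMem hi, hJ]))
    rw [Finset.sum_insert hi] at h1
    convert h1 using 2
    ring
  · intro J hJ
    rw [koszul_apply]
    refine Finset.sum_eq_zero fun i hi => ?_
    rw [Finset.mem_compl] at hi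
    rw [hf.2 (insert i J) (by rw [Finset.card_insert_of_notMem hi]; omega)]
    simp

/-- The cycles of the Koszul complex of degree `n` and homological degree `j`. -/
def koszulCycles (d : Fin m → ℕ) (x : Fin m → N →ₗ[k] N) (A : ℤ → Submodule k N) (j : ℕ) (n : ℤ) :
    Submodule k (Finset (Fin m) → N) :=
  koszulStrand d A j n ⊓ LinearMap.ker (koszul x)

instance finiteDimensional_koszulCycles (d : Fin m → ℕ) (x : Fin m → N →ₗ[k] N)
    (A : ℤ → Submodule k N) [∀ n, FiniteDimensional k (A n)] (j : ℕ) (n : ℤ) :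
    FiniteDimensional k (koszulCycles d x A j n) :=
  Submodule.finiteDimensional_inf_left _ _

/-- The dimension of the Koszul homology of degree `n` and homological degree `j`. -/
noncomputable def koszulBetti (d : Fin m → ℕ) (x : Fin m → N →ₗ[k] N) (A : ℤ → Submodule k N)
    (j : ℕ) (n : ℤ) : ℤ :=
  Module.finrank k (koszulCycles d x A j n) + Module.finrank k (koszulCycles d x A (j + 1) n) -
    Module.finrank k (koszulStrand d A (j + 1) n)

theorem koszulStrand_zero_le_ker (d : Fin m → ℕ) (x : Fin m → N →ₗ[k] N) (A : ℤ → Submodule k N)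
    (n : ℤ) : koszulStrand d A 0 n ≤ LinearMap.ker (koszul x) := by
  intro f hf
  rw [mem_koszulStrand] at hf
  refine funext fun J => ?_
  rw [koszul_apply]
  refine Finset.sum_eq_zero fun i _ => ?_
  rw [hf.2 _ (Finset.card_ne_zero_of_mem (Finset.mem_insert_self i J)), map_zero, smul_zero]

theorem koszulCycles_zero (d : Fin m → ℕ) (x : Fin m → N →ₗ[k] N) (A : ℤ → Submodule k N)
    (n : ℤ) : koszulCycles d x A 0 n = koszulStrand d A 0 n :=
  inf_eq_left.mpr (koszulStrand_zero_le_ker d x A n)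

/-! ### Dimension shifting for Koszul homology. -/

section Shift

variable {d : Fin m → ℕ} {x : Fin m → N →ₗ[k] N} {x' : Fin m → N' →ₗ[k] N'} {φ : N →ₗ[k] N'}
  {A : ℤ → Submodule k N}

theorem map_koszulStrand (j : ℕ) (n : ℤ) :
    (koszulStrand d A j n).map (φ.compLeft _) = koszulStrand d (fun n => (A n).map φ) j n := by
  ext g
  simp only [Submodule.mem_map]
  constructor
  · rintro ⟨f, hf, rfl⟩
    rw [mem_koszulStrand] at hf ⊢
    exact ⟨fun J hJ => ⟨f J, hf.1 J hJ, rfl⟩, fun J hJ => by simp [hf.2 J hJ]⟩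
  · intro hg
    rw [mem_koszulStrand] at hg
    have : ∀ J, ∃ v, (J.card = j → v ∈ A (n - ∑ i ∈ J, (d i : ℤ))) ∧ (J.card ≠ j → v = 0) ∧
        φ v = g J := by
      intro J
      by_cases hJ : J.card = j
      · obtain ⟨v, hv, hv'⟩ := hg.1 J hJ
        exact ⟨v, fun _ => hv, fun h => absurd hJ h, hv'⟩
      · exact ⟨0, fun h => absurd h hJ, fun _ => rfl, by simp [hg.2 J hJ]⟩
    choose f hf using this
    exact ⟨f, mem_koszulStrand.mpr ⟨fun J => (hf J).1, fun J => (hf J).2.1⟩,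
      funext fun J => (hf J).2.2⟩

theorem koszulStrand_inf_ker (j : ℕ) (n : ℤ) :
    koszulStrand d A j n ⊓ LinearMap.ker (φ.compLeft (Finset (Fin m))) =
      koszulStrand d (fun n => A n ⊓ LinearMap.ker φ) j n := by
  ext f
  simp only [Submodule.mem_inf, mem_koszulStrand, LinearMap.mem_ker]
  constructor
  · rintro ⟨h, h'⟩
    exact ⟨fun J hJ => ⟨h.1 J hJ, congrFun h' J⟩, h.2⟩
  · rintro ⟨h, h'⟩
    refine ⟨⟨fun J hJ => (h J hJ).1, h'⟩, funext fun J => ?_⟩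
    by_cases hJ : J.card = j
    · exact (h J hJ).2
    · simp [h' J hJ]

variable [∀ n, FiniteDimensional k (A n)]

theorem finrank_koszulStrand_map_add (j : ℕ) (n : ℤ) :
    Module.finrank k (koszulStrand d (fun n => (A n).map φ) j n) +
      Module.finrank k (koszulStrand d (fun n => A n ⊓ LinearMap.ker φ) j n) =
      Module.finrank k (koszulStrand d A j n) := by
  rw [← map_koszulStrand, ← koszulStrand_inf_ker, finrank_map_add_finrank_inf_ker]

/-- Two ways to count the chains of `A` whose boundary lies in the kernel of `φ`. -/
theorem finrank_koszulCycles_map_add (hx : ∀ i j v, x i (x j v) = x j (x i v))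
    (hφ : ∀ i v, φ (x i v) = x' i (φ v)) (hA : IsGradedAction d x A) {j : ℕ} {n : ℤ}
    (hexact : koszulCycles d x (fun n => A n ⊓ LinearMap.ker φ) j n ≤
      (koszulStrand d A (j + 1) n).map (koszul x)) :
    Module.finrank k (koszulCycles d x' (fun n => (A n).map φ) (j + 1) n) +
      Module.finrank k (koszulStrand d (fun n => A n ⊓ LinearMap.ker φ) (j + 1) n) =
    Module.finrank k (koszulCycles d x (fun n => A n ⊓ LinearMap.ker φ) j n) +
      Module.finrank k (koszulCycles d x A (j + 1) n) := by
  -- G consists of the chains of A whose boundary dies under φ. Rank-nullity on G is used twice: φ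
  -- maps G onto the cycles of the image, with kernel the chains of ker φ; ∂ maps G onto the cycles
  -- of ker φ (by `hexact`), with kernel the cycles of A.
  set G : Submodule k (Finset (Fin m) → N) :=
    koszulStrand d A (j + 1) n ⊓ LinearMap.ker (φ.compLeft _ ∘ₗ koszul x) with hG
  have : FiniteDimensional k G := Submodule.finiteDimensional_inf_left _ _
  have mem_G : ∀ f, f ∈ G ↔ f ∈ koszulStrand d A (j + 1) n ∧
      φ.compLeft _ (koszul x f) = 0 := fun f => Iff.rfl
  have e1 := finrank_map_add_finrank_inf_ker (φ.compLeft (Finset (Fin m))) G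
  have e2 := finrank_map_add_finrank_inf_ker (koszul x) G
  have h1 : G.map (φ.compLeft _) = koszulCycles d x' (fun n => (A n).map φ) (j + 1) n := by
    rw [koszulCycles, ← map_koszulStrand]
    ext g
    simp only [Submodule.mem_map, Submodule.mem_inf, LinearMap.mem_ker, mem_G]
    constructor
    · rintro ⟨f, ⟨hf, hf'⟩, rfl⟩
      exact ⟨⟨f, hf, rfl⟩, by rw [← koszul_naturality hφ, hf']⟩
    · rintro ⟨⟨f, hf, rfl⟩, hf'⟩
      exact ⟨f, ⟨hf, by rw [koszul_naturality hφ, hf']⟩, rfl⟩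
  have h2 : G ⊓ LinearMap.ker (φ.compLeft _) =
      koszulStrand d (fun n => A n ⊓ LinearMap.ker φ) (j + 1) n := by
    rw [← koszulStrand_inf_ker]
    ext f
    simp only [Submodule.mem_inf, LinearMap.mem_ker, mem_G]
    refine ⟨fun h => ⟨h.1.1, h.2⟩, fun h => ⟨⟨h.1, ?_⟩, h.2⟩⟩
    rw [koszul_naturality hφ, h.2, map_zero]
  have h3 : G.map (koszul x) = koszulCycles d x (fun n => A n ⊓ LinearMap.ker φ) j n := by
    apply le_antisymm
    · rintro _ ⟨f, hf, rfl⟩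
      refine ⟨?_, koszul_koszul hx f⟩
      rw [← koszulStrand_inf_ker]
      exact ⟨hA.koszul_mem ((mem_G f).1 hf).1, ((mem_G f).1 hf).2⟩
    · intro g hg
      obtain ⟨f, hf, rfl⟩ := hexact hg
      refine ⟨f, (mem_G f).2 ⟨hf, ?_⟩, rfl⟩
      have := hg.1
      rw [← koszulStrand_inf_ker] at this
      exact this.2
  have h4 : G ⊓ LinearMap.ker (koszul x) = koszulCycles d x A (j + 1) n := by
    ext f
    simp only [koszulCycles, Submodule.mem_inf, LinearMap.mem_ker, mem_G]
    exact ⟨fun h => ⟨h.1.1, h.2⟩, fun h => ⟨⟨h.1, by rw [h.2, map_zero]⟩, h.2⟩⟩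
  rw [h1, h2] at e1
  rw [h3, h4] at e2
  rw [e1, e2]

/-- The dimension shift for Koszul homology along a surjection from an acyclic graded space. -/
theorem koszulBetti_map (hx : ∀ i j v, x i (x j v) = x j (x i v))
    (hφ : ∀ i v, φ (x i v) = x' i (φ v)) (hA : IsGradedAction d x A) {n : ℤ}
    (hacyclic : ∀ j, koszulCycles d x A (j + 1) n ≤ (koszulStrand d A (j + 1 + 1) n).map (koszul x))
    (hmin : koszulStrand d (fun n => A n ⊓ LinearMap.ker φ) 0 n ≤
      (koszulStrand d A 1 n).map (koszul x)) (j : ℕ) :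
    koszulBetti d x' (fun n => (A n).map φ) (j + 1) n =
      koszulBetti d x (fun n => A n ⊓ LinearMap.ker φ) j n := by
  -- Cycles of the kernel bound in A: in homological degree 0 because the kernel is decomposable, in
  -- higher degrees because A is acyclic.
  have hexact : ∀ j, koszulCycles d x (fun n => A n ⊓ LinearMap.ker φ) j n ≤
      (koszulStrand d A (j + 1) n).map (koszul x) := by
    intro j f hf
    cases j with
    | zero => exact hmin hf.1
    | succ j =>
      refine hacyclic j ⟨?_, hf.2⟩
      have := hf.1
      rw [← koszulStrand_inf_ker] at this
      exact this.1
  have e1 := finrank_koszulCycles_map_add hx hφ hA (hexact j)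
  have e2 := finrank_koszulCycles_map_add hx hφ hA (hexact (j + 1))
  have e3 := finrank_koszulStrand_map_add (φ := φ) (A := A) (d := d) (j + 1 + 1) n
  have e4 := finrank_map_add_finrank_inf_ker (koszul x) (koszulStrand d A (j + 1 + 1) n)
  have h5 : (koszulStrand d A (j + 1 + 1) n).map (koszul x) = koszulCycles d x A (j + 1) n := by
    refine le_antisymm ?_ (hacyclic j)
    rintro _ ⟨f, hf, rfl⟩
    exact ⟨hA.koszul_mem hf, koszul_koszul hx f⟩
  rw [h5] at e4
  change _ + Module.finrank k (koszulCycles d x A (j + 1 + 1) n) = _ at e4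
  simp only [koszulBetti]
  omega

/-- Passing to a quotient by a subspace of decomposable elements keeps the number of generators. -/
theorem koszulBetti_map_zero (hx : ∀ i j v, x i (x j v) = x j (x i v))
    (hφ : ∀ i v, φ (x i v) = x' i (φ v)) (hA : IsGradedAction d x A) {n : ℤ}
    (hmin : koszulStrand d (fun n => A n ⊓ LinearMap.ker φ) 0 n ≤
      (koszulStrand d A 1 n).map (koszul x)) :
    koszulBetti d x' (fun n => (A n).map φ) 0 n = koszulBetti d x A 0 n := by
  have e1 := finrank_koszulCycles_map_add hx hφ hA (j := 0) (n := n)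
    (by rw [koszulCycles_zero]; exact hmin)
  have e2 := finrank_koszulStrand_map_add (φ := φ) (A := A) (d := d) 0 n
  have e3 := finrank_koszulStrand_map_add (φ := φ) (A := A) (d := d) (0 + 1) n
  rw [koszulCycles_zero] at e1
  rw [koszulBetti, koszulBetti, koszulCycles_zero, koszulCycles_zero]
  omega

end Shift

end Koszul

/-! ### Acyclicity of the Koszul complex of a graded free module. -/

section Free

open MvPolynomial

variable {k : Type*} [Field k] {m : ℕ}

/-- Functions supported on `p` form a space of dimension the cardinality of `p`. -/
theorem finrank_pi_ite {ι : Type*} [Fintype ι] (p : ι → Prop) [DecidablePred p] :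
    Module.finrank k (Submodule.pi Set.univ fun i => if p i then (⊤ : Submodule k k) else ⊥ :
      Submodule k (ι → k)) = (Finset.univ.filter p).card := by
  have hmem : ∀ w : ι → k, w ∈ (Submodule.pi Set.univ fun i =>
      if p i then (⊤ : Submodule k k) else ⊥ : Submodule k (ι → k)) ↔ ∀ i, ¬ p i → w i = 0 := by
    intro w
    simp only [Submodule.mem_pi, Set.mem_univ, forall_true_left]
    refine forall_congr' fun i => ?_
    by_cases h : p i <;> simp [h]
  let g : (Submodule.pi Set.univ fun i => if p i then (⊤ : Submodule k k) else ⊥ :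
      Submodule k (ι → k)) ≃ₗ[k] ({i // p i} → k) :=
    { toFun := fun w i => w.1 i
      map_add' := fun _ _ => rfl
      map_smul' := fun _ _ => rfl
      invFun := fun u => ⟨fun i => if h : p i then u ⟨i, h⟩ else 0,
        (hmem _).2 fun i hi => by simp [hi]⟩
      left_inv := fun w => by
        ext i
        by_cases h : p i
        · simp [h]
        · simp [h, (hmem _).1 w.2 i h]
      right_inv := fun u => by
        ext i
        simp [i.2] }
  rw [g.finrank_eq, Module.finrank_fintype_fun_eq_card, Fintype.card_subtype]

/-- The terms of a polynomial with exponents in `P`. -/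
noncomputable def coeffFilter (P : (Fin m →₀ ℕ) → Prop) [DecidablePred P] :
    MvPolynomial (Fin m) k →ₗ[k] MvPolynomial (Fin m) k where
  toFun p := ∑ a ∈ p.support with P a, monomial a (coeff a p)
  map_add' p q := by
    classical
    ext b
    simp only [coeff_sum, coeff_monomial, coeff_add, Finset.sum_ite_eq', Finset.mem_filter,
      mem_support_iff]
    by_cases h : P b
    · simp only [h, and_true]
      split_ifs <;> simp_all
    · simp [h]
  map_smul' c p := by
    classical
    ext b
    simp only [coeff_sum, coeff_monomial, coeff_smul, Finset.sum_ite_eq', Finset.mem_filter,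
      mem_support_iff, RingHom.id_apply]
    by_cases h : P b
    · simp only [h, and_true]
      split_ifs <;> simp_all
    · simp [h]

theorem coeff_coeffFilter (P : (Fin m →₀ ℕ) → Prop) [DecidablePred P] (p : MvPolynomial (Fin m) k)
    (b : Fin m →₀ ℕ) : coeff b (coeffFilter P p) = if P b then coeff b p else 0 := by
  classical
  simp only [coeffFilter, LinearMap.coe_mk, AddHom.coe_mk, coeff_sum, coeff_monomial,
    Finset.sum_ite_eq', Finset.mem_filter, mem_support_iff]
  by_cases h : P b <;> simp [h]
  exact fun h => h.symm

variable {r : ℕ}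

/-- Multiplication by the variable `X i` on a free module. -/
noncomputable def freeX (r : ℕ) (i : Fin m) :
    (Fin r → MvPolynomial (Fin m) k) →ₗ[k] (Fin r → MvPolynomial (Fin m) k) :=
  (LinearMap.mulLeft k (X i)).compLeft (Fin r)

theorem freeX_apply (i : Fin m) (v : Fin r → MvPolynomial (Fin m) k) (l : Fin r) :
    freeX r i v l = X i * v l := rfl

theorem freeX_eq_smul (i : Fin m) (v : Fin r → MvPolynomial (Fin m) k) :
    freeX r i v = (X i : MvPolynomial (Fin m) k) • v := rfl

theorem freeX_comm (i j : Fin m) (v : Fin r → MvPolynomial (Fin m) k) :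
    freeX r i (freeX r j v) = freeX r j (freeX r i v) := by
  funext l
  simp only [freeX_apply]
  ring

/-- The contracting homotopy of the Koszul complex of a polynomial ring: it removes the least
variable that occurs in a monomial form. -/
noncomputable def koszulHomotopy (f : Finset (Fin m) → Fin r → MvPolynomial (Fin m) k) :
    Finset (Fin m) → Fin r → MvPolynomial (Fin m) k := fun J l =>
  if h : J.Nonempty then
    coeffFilter (fun a => ∀ i < J.min' h, a i = 0)
      ((f (J.erase (J.min' h)) l).divMonomial (Finsupp.single (J.min' h) 1))
  else 0

theorem coeff_koszulHomotopy (f : Finset (Fin m) → Fin r → MvPolynomial (Fin m) k)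
    {J : Finset (Fin m)} {i : Fin m} (hi : i ∈ J) (hmin : ∀ j ∈ J, i ≤ j) (l : Fin r)
    (a : Fin m →₀ ℕ) : coeff a (koszulHomotopy f J l) =
      if ∀ j < i, a j = 0 then coeff (a + Finsupp.single i 1) (f (J.erase i) l) else 0 := by
  have h : J.Nonempty := ⟨i, hi⟩
  have hm : J.min' h = i := le_antisymm (J.min'_le i hi) (hmin _ (J.min'_mem h))
  rw [koszulHomotopy, dif_pos h, coeff_coeffFilter, coeff_divMonomial, hm, add_comm]

theorem koszulSign_of_lt {j : Fin m} {J : Finset (Fin m)} (h : ∀ i ∈ J, j ≤ i) :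
    koszulSign j J = 1 := by
  rw [koszulSign, Finset.filter_false_of_mem fun i hi => not_lt.mpr (h i hi)]
  simp

theorem koszulSign_erase {i j : Fin m} {J : Finset (Fin m)} (hi : i ∈ J) (hij : i < j) :
    koszulSign j (J.erase i) = -koszulSign j J := by
  rw [koszulSign, koszulSign, Finset.filter_erase,
    ← Finset.card_erase_add_one (s := J.filter (· < j)) (a := i) (by simp [hi, hij])]
  ring

theorem coeff_koszul_freeX (f : Finset (Fin m) → Fin r → MvPolynomial (Fin m) k)
    (J : Finset (Fin m)) (l : Fin r) (a : Fin m →₀ ℕ) :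
    coeff a (koszul (freeX r) f J l) = ∑ j ∈ Jᶜ, koszulSign j J •
      if a j ≠ 0 then coeff (a - Finsupp.single j 1) (f (insert j J) l) else 0 := by
  rw [koszul_apply, Finset.sum_apply, coeff_sum]
  refine Finset.sum_congr rfl fun j _ => ?_
  rw [Pi.smul_apply, coeff_smul, freeX_apply, coeff_X_mul']
  simp only [Finsupp.mem_support_iff]

/-- Coefficients are compared at each pair (J, a). The homotopy depends only on the least index i of
J ∪ supp a: if i lies in J, the cycle equation at J \ {i} recovers the coefficient; otherwise a
single summand survives. The constant terms at J = ∅ have to be excluded, since they represent the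
homology in degree 0. -/
theorem koszul_koszulHomotopy {f : Finset (Fin m) → Fin r → MvPolynomial (Fin m) k}
    (hf : koszul (freeX r) f = 0) (h0 : ∀ l, constantCoeff (f ∅ l) = 0) :
    koszul (freeX r) (koszulHomotopy f) = f := by
  funext J l
  ext a
  rw [coeff_koszul_freeX]
  rcases (J ∪ a.support).eq_empty_or_nonempty with hemp | hne
  · rw [Finset.union_eq_empty, Finsupp.support_eq_empty] at hemp
    rw [hemp.1, hemp.2]
    have := h0 l
    rw [constantCoeff_eq] at this
    rw [this]
    simp
  set i := (J ∪ a.support).min' hne with hi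
  have hmem := (J ∪ a.support).min'_mem hne
  rw [← hi] at hmem
  have hle : ∀ j ∈ J, i ≤ j := fun j hj =>
    (J ∪ a.support).min'_le j (Finset.mem_union_left _ hj)
  have hle' : ∀ j, a j ≠ 0 → i ≤ j := fun j hj =>
    (J ∪ a.support).min'_le j (Finset.mem_union_right _ (Finsupp.mem_support_iff.mpr hj))
  have hlt : ∀ j < i, a j = 0 := fun j hj => by
    by_contra hne
    exact absurd (hle' j hne) (not_le.mpr hj)
  clear_value i
  by_cases hiJ : i ∈ J
  -- The cycle equation at J \ {i} and exponent a + e_i expresses the coefficient of f at (J, a)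
  -- through terms with other indices j. They agree one by one with the summands of the boundary of
  -- the homotopy, because removing i < j from J flips the sign of j.
  · have hcyc := congrArg (coeff (a + Finsupp.single i 1))
      (congrFun (congrFun hf (J.erase i)) l)
    rw [coeff_koszul_freeX, Finset.compl_erase, Finset.sum_insert (by simpa using hiJ),
      koszulSign_of_lt (fun j hj => hle j (Finset.mem_of_mem_erase hj)),
      Finset.insert_erase hiJ, if_pos (by simp), add_tsub_cancel_right, one_smul] at hcyc
    rw [Pi.zero_apply, Pi.zero_apply, coeff_zero] at hcyc
    rw [eq_neg_of_add_eq_zero_left hcyc, ← Finset.sum_neg_distrib]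
    refine Finset.sum_congr rfl fun j hj => ?_
    rw [Finset.mem_compl] at hj
    have hji : j ≠ i := fun h => hj (h ▸ hiJ)
    have haj : (a + Finsupp.single i 1 : Fin m →₀ ℕ) j = a j := by simp [hji.symm]
    rw [haj]
    by_cases hj0 : a j = 0
    · simp [hj0]
    have hij : i < j := lt_of_le_of_ne (hle' j hj0) hji.symm
    rw [if_pos hj0, if_pos hj0, koszulSign_erase hiJ hij, neg_smul, neg_neg,
      coeff_koszulHomotopy f (Finset.mem_insert_of_mem hiJ) (i := i), if_pos,
      Finset.erase_insert_of_ne hji]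
    · congr 2
      ext t
      simp only [Finsupp.coe_add, Finsupp.coe_tsub, Pi.add_apply, Pi.sub_apply,
        Finsupp.single_apply]
      by_cases htj : j = t
      · subst htj
        simp [hji.symm]
      · simp [htj]
    · intro t ht
      simp [hlt t ht]
    · intro t ht
      rcases Finset.mem_insert.mp ht with rfl | ht
      · exact hij.le
      · exact hle t ht
  · have hai : a i ≠ 0 := by
      rcases Finset.mem_union.mp hmem with h | h
      · exact absurd h hiJ
      · exact Finsupp.mem_support_iff.mp h
    rw [Finset.sum_eq_single i]
    · rw [koszulSign_of_lt hle, one_smul, if_pos hai,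
        coeff_koszulHomotopy f (Finset.mem_insert_self i J), if_pos, Finset.erase_insert hiJ,
        tsub_add_cancel_of_le]
      · rw [Finsupp.single_le_iff]
        omega
      · intro t ht
        simp [hlt t ht]
      · intro t ht
        rcases Finset.mem_insert.mp ht with rfl | ht
        · exact le_rfl
        · exact hle t ht
    -- For j ≠ i with a j ≠ 0, the least element of J ∪ {j} exceeds i while a i ≠ 0, so the filter
    -- in the homotopy discards the term.
    · intro j hj hji
      rw [Finset.mem_compl] at hj
      by_cases hj0 : a j = 0
      · simp [hj0]
      have hij : i < j := lt_of_le_of_ne (hle' j hj0) hji.symm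
      have hne : (insert j J).Nonempty := ⟨j, Finset.mem_insert_self j J⟩
      rw [if_pos hj0, coeff_koszulHomotopy f ((insert j J).min'_mem hne)
        (fun t ht => (insert j J).min'_le t ht), if_neg, smul_zero]
      intro h
      refine hai ?_
      have := h i ?_
      · simpa [Finsupp.single_apply, hji] using this
      · rcases Finset.mem_insert.mp ((insert j J).min'_mem hne) with h | h
        · rw [h]
          exact hij
        · exact lt_of_le_of_ne (hle _ h) fun he => hiJ (he ▸ h)
    · intro h
      exact absurd (Finset.mem_compl.mpr hiJ) h

/-- The part of degree `n` of the graded free module with basis elements of degrees `e l`. -/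
def freePart (k : Type*) [Field k] (d : Fin m → ℕ) (e : Fin r → ℕ) (n : ℤ) :
    Submodule k (Fin r → MvPolynomial (Fin m) k) where
  carrier := {v | ∀ l a, coeff a (v l) ≠ 0 → ((Finsupp.weight d a + e l : ℕ) : ℤ) = n}
  add_mem' {v w} hv hw l a h := by
    by_cases h' : coeff a (v l) = 0
    · exact hw l a (by simpa [h'] using h)
    · exact hv l a h'
  zero_mem' := by simp
  smul_mem' c v hv l a h := hv l a (right_ne_zero_of_mul (a := c) (by simpa using h))

theorem isGradedAction_freePart (d : Fin m → ℕ) (e : Fin r → ℕ) :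
    IsGradedAction d (freeX r) (freePart k d e) := by
  intro i n v hv l a h
  rw [freeX_apply, coeff_X_mul'] at h
  split_ifs at h with hi
  · have h1 := hv l _ h
    have h2 : Finsupp.single i 1 ≤ a := by
      rw [Finsupp.single_le_iff]
      have := Finsupp.mem_support_iff.mp hi
      omega
    have h3 := congrArg (Finsupp.weight d) (tsub_add_cancel_of_le h2)
    rw [map_add, Finsupp.weight_single, one_smul] at h3
    push_cast at h1 ⊢
    omega
  · exact absurd rfl h

theorem finiteDimensional_freePart {d : Fin m → ℕ} (hd : ∀ i, 0 < d i) (e : Fin r → ℕ) (n : ℤ) :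
    FiniteDimensional k (freePart k d e n) := by
  -- The weights are positive, so an exponent of an element of degree n has all entries at most n;
  -- finitely many coefficients therefore determine the element.
  let g : freePart k d e n →ₗ[k] (Fin r × (Fin m → Fin (n.toNat + 1)) → k) :=
    { toFun := fun v p => coeff (Finsupp.equivFunOnFinite.symm fun i => (p.2 i : ℕ)) (v.1 p.1)
      map_add' := fun _ _ => by
        ext
        simp
      map_smul' := fun _ _ => by
        ext
        simp }
  refine FiniteDimensional.of_injective g fun v w h => ?_
  ext l a
  by_cases ha : ∀ i, a i ≤ n.toNat
  · have := congrFun h (l, fun i => ⟨a i, Nat.lt_succ_of_le (ha i)⟩)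
    simpa [g] using this
  · push Not at ha
    obtain ⟨i, hi⟩ := ha
    have key : ∀ u : freePart k d e n, coeff a (u.1 l) = 0 := by
      intro u
      by_contra hne
      have h1 := u.2 l a hne
      have h2 : a i ≤ Finsupp.weight d a := Finsupp.le_weight d (hd i).ne' a
      omega
    rw [key, key]

theorem koszulHomotopy_mem {d : Fin m → ℕ} {e : Fin r → ℕ} {j : ℕ} {n : ℤ}
    {f : Finset (Fin m) → Fin r → MvPolynomial (Fin m) k}
    (hf : f ∈ koszulStrand d (freePart k d e) j n) :
    koszulHomotopy f ∈ koszulStrand d (freePart k d e) (j + 1) n := by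
  rw [mem_koszulStrand] at hf ⊢
  constructor
  · intro J hJ l a ha
    have hne : J.Nonempty := by
      rw [← Finset.card_pos]
      omega
    have hm := J.min'_mem hne
    rw [coeff_koszulHomotopy f hm fun t ht => J.min'_le t ht] at ha
    split_ifs at ha with h
    · have h1 := hf.1 (J.erase (J.min' hne)) (by rw [Finset.card_erase_of_mem hm]; omega) l _ ha
      have h2 := Finset.sum_erase_add J (fun i => (d i : ℤ)) hm
      rw [map_add, Finsupp.weight_single, one_smul] at h1
      push_cast at h1 ⊢
      linarith
    · exact absurd rfl ha
  · intro J hJ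
    funext l
    rcases J.eq_empty_or_nonempty with rfl | hne
    · simp [koszulHomotopy]
    · have hm := J.min'_mem hne
      ext a
      have := Finset.card_pos.mpr hne
      rw [coeff_koszulHomotopy f hm fun t ht => J.min'_le t ht,
        hf.2 _ (by rw [Finset.card_erase_of_mem hm]; omega)]
      simp

theorem koszulCycles_freePart_le (d : Fin m → ℕ) (e : Fin r → ℕ) (j : ℕ) (n : ℤ) :
    koszulCycles d (freeX r) (freePart k d e) (j + 1) n ≤
      (koszulStrand d (freePart k d e) (j + 1 + 1) n).map (koszul (freeX r)) := fun f hf =>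
  ⟨koszulHomotopy f, koszulHomotopy_mem hf.1, koszul_koszulHomotopy hf.2 fun l => by
    rw [(mem_koszulStrand.mp hf.1).2 ∅ (by simp), Pi.zero_apply, map_zero]⟩

/-- An element without constant terms lies in (X_1, …, X_m) times the free module, and the homotopy
provides the coefficients. This is how minimality of the resolution enters the dimension shift. -/
theorem koszulStrand_zero_le_map {d : Fin m → ℕ} {e : Fin r → ℕ} {n : ℤ}
    {A : ℤ → Submodule k (Fin r → MvPolynomial (Fin m) k)} (hA : ∀ n, A n ≤ freePart k d e n)
    (h : ∀ n, ∀ v ∈ A n, ∀ l, constantCoeff (v l) = 0) :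
    koszulStrand d A 0 n ≤ (koszulStrand d (freePart k d e) 1 n).map (koszul (freeX r)) := by
  intro f hf
  refine ⟨koszulHomotopy f, koszulHomotopy_mem (j := 0) ?_,
    koszul_koszulHomotopy (koszulStrand_zero_le_ker d _ A n hf)
      (h _ _ ((mem_koszulStrand.mp hf).1 ∅ rfl))⟩
  rw [mem_koszulStrand] at hf ⊢
  exact ⟨fun J hJ => hA _ (hf.1 J hJ), hf.2⟩

theorem koszulBetti_freePart_zero {d : Fin m → ℕ} (hd : ∀ i, 0 < d i) (e : Fin r → ℕ) (n : ℤ) :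
    koszulBetti d (freeX r) (freePart k d e) 0 n =
      (Finset.univ.filter fun l => (e l : ℤ) = n).card := by
  have hfin : ∀ n, FiniteDimensional k (freePart k d e n) := finiteDimensional_freePart hd e
  -- χ reads off constant terms. On chains of homological degree 0 its kernel is the space of
  -- boundaries, so its image represents the homology.
  let χ : (Finset (Fin m) → Fin r → MvPolynomial (Fin m) k) →ₗ[k] (Fin r → k) :=
    { toFun := fun f l => coeff 0 (f ∅ l)
      map_add' := fun _ _ => by
        ext
        simp
      map_smul' := fun _ _ => by
        ext
        simp }
  have e1 := finrank_map_add_finrank_inf_ker χ (koszulStrand d (freePart k d e) 0 n)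
  have e2 := finrank_map_add_finrank_inf_ker (koszul (freeX r))
    (koszulStrand d (freePart k d e) (0 + 1) n)
  have h1 : (koszulStrand d (freePart k d e) 0 n).map χ =
      Submodule.pi Set.univ fun l => if (e l : ℤ) = n then ⊤ else ⊥ := by
    ext w
    simp only [Submodule.mem_map, Submodule.mem_pi, Set.mem_univ, forall_true_left]
    constructor
    · rintro ⟨f, hf, rfl⟩ l
      split_ifs with h
      · trivial
      · by_contra hne
        have := (mem_koszulStrand.mp hf).1 ∅ rfl l 0 hne
        simp only [map_zero, zero_add, Finset.sum_empty, sub_zero] at this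
        exact h this
    · intro hw
      refine ⟨fun J => if J = ∅ then fun l => C (w l) else 0, ?_, ?_⟩
      · rw [mem_koszulStrand]
        constructor
        · intro J hJ l a ha
          rw [Finset.card_eq_zero] at hJ
          subst hJ
          simp only [if_true, coeff_C] at ha
          split_ifs at ha with h0
          · subst h0
            have := hw l
            split_ifs at this with h
            · simpa using h
            · exact absurd this ha
          · exact absurd rfl ha
        · intro J hJ
          rw [Ne, Finset.card_eq_zero] at hJ
          simp [hJ]
      · ext l
        simp [χ]
  have h2 : koszulStrand d (freePart k d e) 0 n ⊓ LinearMap.ker χ =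
      (koszulStrand d (freePart k d e) (0 + 1) n).map (koszul (freeX r)) := by
    apply le_antisymm
    · rintro f ⟨hf, hf'⟩
      exact ⟨koszulHomotopy f, koszulHomotopy_mem hf,
        koszul_koszulHomotopy (koszulStrand_zero_le_ker d _ _ n hf) fun l => congrFun hf' l⟩
    · rintro _ ⟨f, hf, rfl⟩
      refine ⟨(isGradedAction_freePart d e).koszul_mem hf, ?_⟩
      ext l
      change coeff 0 (koszul (freeX r) f ∅ l) = 0
      rw [coeff_koszul_freeX]
      simp
  rw [h1, h2, finrank_pi_ite] at e1
  change _ + Module.finrank k (koszulCycles d (freeX r) (freePart k d e) (0 + 1) n) = _ at e2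
  rw [koszulBetti, koszulCycles_zero]
  omega

end Free

/-! ### Syzygy degrees as Koszul homology of the semigroup ring. -/

section GradedExactness

open MvPolynomial

variable {k : Type*} [Field k] {m r : ℕ}

/-- The component of degree `n` of an element of a graded free module. -/
noncomputable def freeComponent (d : Fin m → ℕ) (e : Fin r → ℕ) (n : ℤ) :
    (Fin r → MvPolynomial (Fin m) k) →ₗ[k] (Fin r → MvPolynomial (Fin m) k) :=
  LinearMap.pi fun l =>
    coeffFilter (fun a => ((Finsupp.weight d a + e l : ℕ) : ℤ) = n) ∘ₗ LinearMap.proj l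

theorem coeff_freeComponent (d : Fin m → ℕ) (e : Fin r → ℕ) (n : ℤ)
    (v : Fin r → MvPolynomial (Fin m) k) (l : Fin r) (a : Fin m →₀ ℕ) :
    coeff a (freeComponent d e n v l) =
      if ((Finsupp.weight d a + e l : ℕ) : ℤ) = n then coeff a (v l) else 0 := by
  simp only [freeComponent, LinearMap.pi_apply, LinearMap.comp_apply, LinearMap.proj_apply,
    coeff_coeffFilter]

theorem freeComponent_mem (d : Fin m → ℕ) (e : Fin r → ℕ) (n : ℤ)
    (v : Fin r → MvPolynomial (Fin m) k) : freeComponent d e n v ∈ freePart k d e n := by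
  intro l a h
  rw [coeff_freeComponent] at h
  by_contra hne
  exact h (if_neg hne)

theorem freeComponent_of_mem {d : Fin m → ℕ} {e : Fin r → ℕ} {n n' : ℤ}
    {v : Fin r → MvPolynomial (Fin m) k} (hv : v ∈ freePart k d e n') :
    freeComponent d e n v = if n' = n then v else 0 := by
  funext l
  ext a
  rw [coeff_freeComponent]
  by_cases h0 : coeff a (v l) = 0
  · split_ifs <;> simp [h0]
  · rw [hv l a h0]
    split_ifs <;> simp

theorem single_monomial_mem (d : Fin m → ℕ) (e : Fin r → ℕ) (l : Fin r) (a : Fin m →₀ ℕ) (c : k) :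
    (Pi.single l (monomial a c) : Fin r → MvPolynomial (Fin m) k) ∈
      freePart k d e ((Finsupp.weight d a + e l : ℕ) : ℤ) := by
  classical
  intro l' a' h
  rcases eq_or_ne l' l with rfl | hl
  · rw [Pi.single_eq_same, coeff_monomial] at h
    split_ifs at h with ha
    · rw [ha]
    · exact absurd rfl h
  · rw [Pi.single_eq_of_ne hl] at h
    exact absurd (coeff_zero _) h

theorem single_monomial_eq_smul (l : Fin r) (a : Fin m →₀ ℕ) (c : k) :
    (Pi.single l (monomial a c) : Fin r → MvPolynomial (Fin m) k) =
      monomial a c • (Pi.single l 1 : Fin r → MvPolynomial (Fin m) k) := by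
  rw [← Pi.single_smul, smul_eq_mul, mul_one]

theorem free_linearMap_ext {N : Type*} [AddCommGroup N] [Module k N]
    {ψ ψ' : (Fin r → MvPolynomial (Fin m) k) →ₗ[k] N}
    (h : ∀ l a c, ψ (Pi.single l (monomial a c)) = ψ' (Pi.single l (monomial a c))) : ψ = ψ' := by
  refine LinearMap.pi_ext' fun l => MvPolynomial.linearMap_ext fun a => LinearMap.ext fun c => ?_
  exact h l a c

variable {d : Fin m → ℕ}

section Semigroup

theorem weight_mem_semigroup (a : Fin m →₀ ℕ) : Finsupp.weight d a ∈ semigroup d := by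
  rw [Finsupp.weight_apply]
  exact sum_mem fun i _ => nsmul_mem (AddSubmonoid.subset_closure (Set.mem_range_self i)) _

theorem aeval_monomial_X_pow (a : Fin m →₀ ℕ) (c : k) :
    aeval (R := k) (fun i => (Polynomial.X ^ d i : Polynomial k)) (monomial a c) =
      Polynomial.monomial (Finsupp.weight d a) c := by
  rw [aeval_monomial, ← Polynomial.C_mul_X_pow_eq_monomial, Finsupp.weight_apply]
  simp only [Finsupp.prod, Finsupp.sum, ← pow_mul, Finset.prod_pow_eq_pow_sum, smul_eq_mul,
    mul_comm]
  rfl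

theorem coeff_aeval_X_pow (q : MvPolynomial (Fin m) k) (s : ℕ)
    (h : (aeval (R := k) (fun i => (Polynomial.X ^ d i : Polynomial k)) q).coeff s ≠ 0) :
    s ∈ semigroup d := by
  by_contra hs
  refine h ?_
  induction q using MvPolynomial.induction_on' with
  | monomial a c =>
    rw [aeval_monomial_X_pow, Polynomial.coeff_monomial, if_neg]
    rintro rfl
    exact hs (weight_mem_semigroup a)
  | add p q hp hq =>
    rw [map_add, Polynomial.coeff_add]
    by_cases h1 : (aeval (R := k) (fun i => (Polynomial.X ^ d i : Polynomial k)) p).coeff s = 0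
    · by_cases h2 : (aeval (R := k) (fun i => (Polynomial.X ^ d i : Polynomial k)) q).coeff s = 0
      · rw [h1, h2, add_zero]
      · exact absurd (hq h2) h2
    · exact absurd (hp h1) h1

theorem exists_aeval_eq_X_pow {s : ℕ} (hs : s ∈ semigroup d) : ∃ q : MvPolynomial (Fin m) k,
    aeval (R := k) (fun i => (Polynomial.X ^ d i : Polynomial k)) q = Polynomial.X ^ s := by
  induction hs using AddSubmonoid.closure_induction with
  | mem x hx =>
    obtain ⟨i, rfl⟩ := hx
    exact ⟨X i, by simp⟩
  | zero => exact ⟨1, by simp⟩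
  | add x y _ _ hx hy =>
    obtain ⟨p, hp⟩ := hx
    obtain ⟨q, hq⟩ := hy
    exact ⟨p * q, by rw [map_mul, hp, hq, pow_add]⟩

theorem aeval_of_isWeightedHomogeneous {q : MvPolynomial (Fin m) k} {s : ℕ}
    (hq : IsWeightedHomogeneous d q s) : ∃ c : k,
    aeval (R := k) (fun i => (Polynomial.X ^ d i : Polynomial k)) q = Polynomial.monomial s c := by
  refine ⟨∑ a ∈ q.support, coeff a q, ?_⟩
  conv_lhs => rw [q.as_sum]
  rw [map_sum, map_sum]
  refine Finset.sum_congr rfl fun a ha => ?_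
  rw [aeval_monomial_X_pow, hq (mem_support_iff.mp ha)]

end Semigroup

namespace MinimalResolution

section Diff

variable {I : Ideal (MvPolynomial (Fin m) k)} (P : MinimalResolution k d I)

theorem diff_single_monomial_mem (i : ℕ) (j : Fin (P.rank (i + 1))) (a : Fin m →₀ ℕ) (c : k) :
    P.diff i (Pi.single j (monomial a c)) ∈
      freePart k d (P.deg i) ((Finsupp.weight d a + P.deg (i + 1) j : ℕ) : ℤ) := by
  rw [single_monomial_eq_smul, map_smul]
  intro l b hb
  rw [Pi.smul_apply, smul_eq_mul, coeff_monomial_mul'] at hb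
  split_ifs at hb with hab
  · have h1 := P.diff_homogeneous i j l _ (right_ne_zero_of_mul hb)
    have h2 := congrArg (Finsupp.weight d) (tsub_add_cancel_of_le hab)
    rw [map_add] at h2
    rw [Nat.cast_inj]
    omega
  · exact absurd rfl hb

/-- Both sides are linear, so monomial multiples of basis vectors suffice. Commutation with the
projections lets any preimage of a homogeneous element be replaced by a homogeneous one, so
exactness passes to each degree. -/
theorem freeComponent_diff (i : ℕ) (n : ℤ) (v : Fin (P.rank (i + 1)) → MvPolynomial (Fin m) k) :
    freeComponent d (P.deg i) n (P.diff i v) =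
      P.diff i (freeComponent d (P.deg (i + 1)) n v) := by
  have h : freeComponent d (P.deg i) n ∘ₗ (P.diff i).restrictScalars k =
      (P.diff i).restrictScalars k ∘ₗ freeComponent d (P.deg (i + 1)) n := by
    refine free_linearMap_ext fun l a c => ?_
    simp only [LinearMap.comp_apply, LinearMap.restrictScalars_apply]
    rw [freeComponent_of_mem (P.diff_single_monomial_mem i l a c),
      freeComponent_of_mem (single_monomial_mem d (P.deg (i + 1)) l a c)]
    split_ifs
    · rfl
    · rw [map_zero]
  exact LinearMap.congr_fun h v

theorem map_diff_freePart_le (i : ℕ) (n : ℤ) :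
    (freePart k d (P.deg (i + 1)) n).map ((P.diff i).restrictScalars k) ≤
      freePart k d (P.deg i) n := by
  rintro _ ⟨v, hv, rfl⟩
  have h := P.freeComponent_diff i n v
  rw [freeComponent_of_mem hv, if_pos rfl] at h
  rw [LinearMap.restrictScalars_apply, ← h]
  exact freeComponent_mem _ _ _ _

/-- A homogeneous element in the image of a differential is the image of a homogeneous element. -/
theorem mem_map_diff_freePart {i : ℕ} {n : ℤ} {v : Fin (P.rank i) → MvPolynomial (Fin m) k}
    (hv : v ∈ freePart k d (P.deg i) n) (h : v ∈ Set.range (P.diff i)) :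
    v ∈ (freePart k d (P.deg (i + 1)) n).map ((P.diff i).restrictScalars k) := by
  obtain ⟨u, rfl⟩ := h
  refine ⟨freeComponent d (P.deg (i + 1)) n u, freeComponent_mem _ _ _ _, ?_⟩
  rw [LinearMap.restrictScalars_apply, ← P.freeComponent_diff, freeComponent_of_mem hv, if_pos rfl]

theorem freePart_inf_ker_diff (i : ℕ) : (fun n => freePart k d (P.deg (i + 1)) n ⊓
      LinearMap.ker ((P.diff i).restrictScalars k)) =
    fun n => (freePart k d (P.deg (i + 1 + 1)) n).map ((P.diff (i + 1)).restrictScalars k) := by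
  funext n
  apply le_antisymm
  · rintro v ⟨hv, hv'⟩
    exact P.mem_map_diff_freePart hv ((P.exact_succ i v).mp hv')
  · refine le_inf (P.map_diff_freePart_le (i + 1) n) ?_
    rintro _ ⟨u, _, rfl⟩
    exact (P.exact_succ i _).mpr ⟨u, rfl⟩

end Diff

section Aug

variable (P : MinimalResolution k d (semigroupIdeal k d))

/-- The map from `F_0` to `k[z]` with image the semigroup ring. -/
noncomputable def augPoly : (Fin (P.rank 0) → MvPolynomial (Fin m) k) →ₗ[k] Polynomial k :=
  (Ideal.Quotient.liftₐ (semigroupIdeal k d)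
    (aeval (R := k) (fun i => (Polynomial.X ^ d i : Polynomial k))) fun _ ha => ha).toLinearMap ∘ₗ
    P.aug.restrictScalars k

theorem augPoly_of_aug_eq {v : Fin (P.rank 0) → MvPolynomial (Fin m) k}
    {q : MvPolynomial (Fin m) k} (h : P.aug v = Ideal.Quotient.mk _ q) :
    P.augPoly v = aeval (R := k) (fun i => (Polynomial.X ^ d i : Polynomial k)) q := by
  simp only [augPoly, LinearMap.comp_apply, LinearMap.restrictScalars_apply, h]
  rfl

theorem augPoly_smul (q : MvPolynomial (Fin m) k) (v : Fin (P.rank 0) → MvPolynomial (Fin m) k) :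
    P.augPoly (q • v) =
      aeval (R := k) (fun i => (Polynomial.X ^ d i : Polynomial k)) q * P.augPoly v := by
  obtain ⟨p, hp⟩ := Ideal.Quotient.mk_surjective (P.aug v)
  rw [P.augPoly_of_aug_eq hp.symm, P.augPoly_of_aug_eq (q := q * p), map_mul]
  rw [map_smul, ← hp]
  rfl

theorem augPoly_eq_zero_iff {v : Fin (P.rank 0) → MvPolynomial (Fin m) k} :
    P.augPoly v = 0 ↔ P.aug v = 0 := by
  obtain ⟨p, hp⟩ := Ideal.Quotient.mk_surjective (P.aug v)
  rw [P.augPoly_of_aug_eq hp.symm, ← hp, Ideal.Quotient.eq_zero_iff_mem]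
  rfl

/-- The map from `F_0` to `k` obtained by setting `z = 1`. -/
noncomputable def augOne : (Fin (P.rank 0) → MvPolynomial (Fin m) k) →ₗ[k] k :=
  Polynomial.leval 1 ∘ₗ P.augPoly

theorem augOne_apply (v : Fin (P.rank 0) → MvPolynomial (Fin m) k) :
    P.augOne v = (P.augPoly v).eval 1 := rfl

theorem augOne_freeX (i : Fin m) (v : Fin (P.rank 0) → MvPolynomial (Fin m) k) :
    P.augOne (freeX (P.rank 0) i v) = P.augOne v := by
  rw [augOne_apply, freeX_eq_smul, augPoly_smul, augOne_apply]
  simp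

/-- Setting z = 1 loses nothing on a homogeneous element, whose image is a single power of z up to a
scalar. The semigroup ring can thus be modelled inside k, with every variable acting as the
identity. -/
theorem coeff_augPoly (v : Fin (P.rank 0) → MvPolynomial (Fin m) k) (s : ℕ) :
    (P.augPoly v).coeff s = P.augOne (freeComponent d (P.deg 0) s v) := by
  have h : Polynomial.lcoeff k s ∘ₗ P.augPoly = P.augOne ∘ₗ freeComponent d (P.deg 0) s := by
    refine free_linearMap_ext fun l a c => ?_
    obtain ⟨p, hp, hp'⟩ := P.aug_homogeneous l
    obtain ⟨c', hc'⟩ := aeval_of_isWeightedHomogeneous hp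
    have h1 : P.augPoly (Pi.single l (monomial a c)) =
        Polynomial.monomial (Finsupp.weight d a + P.deg 0 l) (c * c') := by
      rw [single_monomial_eq_smul, augPoly_smul, P.augPoly_of_aug_eq hp', hc',
        aeval_monomial_X_pow, Polynomial.monomial_mul_monomial]
    simp only [LinearMap.comp_apply, Polynomial.lcoeff_apply]
    rw [freeComponent_of_mem (single_monomial_mem d (P.deg 0) l a c), h1,
      Polynomial.coeff_monomial]
    by_cases hs : Finsupp.weight d a + P.deg 0 l = s
    · rw [if_pos hs, if_pos (by rw [hs]), augOne_apply, h1]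
      simp
    · rw [if_neg hs, if_neg (by rwa [Nat.cast_inj]), map_zero]
  exact LinearMap.congr_fun h v

theorem freePart_inf_ker_augOne : (fun n => freePart k d (P.deg 0) n ⊓ LinearMap.ker P.augOne) =
    fun n => (freePart k d (P.deg (0 + 1)) n).map ((P.diff 0).restrictScalars k) := by
  funext n
  apply le_antisymm
  · rintro v ⟨hv, hv'⟩
    refine P.mem_map_diff_freePart hv ((P.exact_zero v).mp ?_)
    rw [← augPoly_eq_zero_iff]
    ext s
    rw [coeff_augPoly, freeComponent_of_mem hv, Polynomial.coeff_zero]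
    split_ifs
    · exact hv'
    · exact map_zero _
  · refine le_inf (P.map_diff_freePart_le 0 n) ?_
    rintro _ ⟨u, _, rfl⟩
    have h : P.aug (P.diff 0 u) = 0 := (P.exact_zero _).mpr ⟨u, rfl⟩
    rw [← augPoly_eq_zero_iff] at h
    rw [LinearMap.mem_ker, augOne_apply, LinearMap.restrictScalars_apply, h, Polynomial.eval_zero]

open Classical in
/-- The graded pieces of the semigroup ring. -/
theorem map_augOne_freePart : (fun n => (freePart k d (P.deg 0) n).map P.augOne) =
    fun n => if n ∈ intSet (semigroup d) then (⊤ : Submodule k k) else ⊥ := by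
  funext n
  split_ifs with hn
  · obtain ⟨s, hs, rfl⟩ := hn
    obtain ⟨q, hq⟩ := exists_aeval_eq_X_pow (k := k) hs
    obtain ⟨v, hv⟩ := P.aug_surjective (Ideal.Quotient.mk _ q)
    have h1 : P.augOne (freeComponent d (P.deg 0) s v) = 1 := by
      rw [← coeff_augPoly, P.augPoly_of_aug_eq hv, hq, Polynomial.coeff_X_pow_self]
    rw [eq_top_iff]
    intro c _
    refine ⟨c • freeComponent d (P.deg 0) s v,
      Submodule.smul_mem _ _ (freeComponent_mem _ _ _ _), ?_⟩
    rw [map_smul, h1, smul_eq_mul, mul_one]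
  · rw [eq_bot_iff]
    rintro _ ⟨v, hv, rfl⟩
    rw [Submodule.mem_bot]
    by_contra hne
    have hv0 : 0 ≤ n := by
      by_contra hneg
      refine hne ?_
      have : v = 0 := by
        funext l
        ext a
        by_contra h
        have := hv l a h
        omega
      rw [this, map_zero]
    lift n to ℕ using hv0
    obtain ⟨q, hq⟩ := Ideal.Quotient.mk_surjective (P.aug v)
    refine hn ⟨n, coeff_aeval_X_pow (k := k) q n ?_, rfl⟩
    rw [← P.augPoly_of_aug_eq hq.symm, coeff_augPoly, freeComponent_of_mem hv, if_pos rfl]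
    exact hne

/-- Induction on i: each step replaces the image of a differential by the kernel of the preceding
map and shifts the homological degree by one. The first map of the chain is `augOne`, which accounts
for the shift i + 1. -/
theorem koszulBetti_map_diff (hd : ∀ i, 0 < d i) (i j : ℕ) (n : ℤ) :
    koszulBetti d (freeX _) (fun n => (freePart k d (P.deg (i + 1)) n).map
      ((P.diff i).restrictScalars k)) j n =
    koszulBetti d (fun _ => LinearMap.id) (fun n => (freePart k d (P.deg 0) n).map P.augOne)
      (j + (i + 1)) n := by
  have hfin : ∀ i n, FiniteDimensional k (freePart k d (P.deg i) n) :=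
    fun i => finiteDimensional_freePart hd (P.deg i)
  have hmin : ∀ i, koszulStrand d (fun n => (freePart k d (P.deg (i + 1)) n).map
      ((P.diff i).restrictScalars k)) 0 n ≤
      (koszulStrand d (freePart k d (P.deg i)) 1 n).map (koszul (freeX _)) := by
    refine fun i => koszulStrand_zero_le_map (P.map_diff_freePart_le i) ?_
    rintro n _ ⟨u, _, rfl⟩ l
    exact P.minimal i u l
  induction i generalizing j with
  | zero =>
    rw [← freePart_inf_ker_augOne]
    refine (koszulBetti_map freeX_comm P.augOne_freeX (isGradedAction_freePart d _)
      (fun j => koszulCycles_freePart_le d _ j n) ?_ j).symm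
    rw [freePart_inf_ker_augOne]
    exact hmin 0
  | succ i ih =>
    rw [← freePart_inf_ker_diff, ← add_assoc, add_right_comm, ← ih (j + 1)]
    refine (koszulBetti_map freeX_comm (fun a v => ?_) (isGradedAction_freePart d _)
      (fun j => koszulCycles_freePart_le d _ j n) ?_ j).symm
    · rw [freeX_eq_smul, freeX_eq_smul, LinearMap.restrictScalars_apply, map_smul]
      rfl
    · rw [freePart_inf_ker_diff]
      exact hmin (i + 1)

/-- The number of basis elements of degree `n` in a minimal graded free resolution of the semigroup
ring is the dimension of the Koszul homology of the semigroup ring in degree `n`. -/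
theorem card_filter_deg_eq (hd : ∀ i, 0 < d i) (i : ℕ) (n : ℤ) :
    ((Finset.univ.filter fun l => (P.deg (i + 1) l : ℤ) = n).card : ℤ) =
    koszulBetti d (fun _ => LinearMap.id) (fun n => (freePart k d (P.deg 0) n).map P.augOne)
      (i + 1) n := by
  have hfin : ∀ i n, FiniteDimensional k (freePart k d (P.deg i) n) :=
    fun i => finiteDimensional_freePart hd (P.deg i)
  rw [← koszulBetti_freePart_zero (k := k) hd, ← zero_add (i + 1), ← koszulBetti_map_diff P hd,
    zero_add]
  refine (koszulBetti_map_zero freeX_comm (fun a v => ?_) (isGradedAction_freePart d _) ?_).symm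
  · rw [freeX_eq_smul, freeX_eq_smul, LinearMap.restrictScalars_apply, map_smul]
    rfl
  · rw [freePart_inf_ker_diff]
    refine koszulStrand_zero_le_map (P.map_diff_freePart_le (i + 1)) ?_
    rintro n _ ⟨u, _, rfl⟩ l
    exact P.minimal (i + 1) u l

end Aug

end MinimalResolution

end GradedExactness

/-! ### The Apéry set of a semigroup of maximal embedding dimension. -/

section MaximalEmbeddingDimension

variable {m : ℕ} {d : Fin m → ℕ}

/-- An element below d i cannot involve d i as a summand. -/
theorem mem_closure_of_lt {i : Fin m} {s : ℕ} (hs : s ∈ semigroup d) (h : s < d i) :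
    s ∈ AddSubmonoid.closure (d '' {i}ᶜ) := by
  induction hs using AddSubmonoid.closure_induction with
  | mem x hx =>
    obtain ⟨j, rfl⟩ := hx
    refine AddSubmonoid.subset_closure ⟨j, ?_, rfl⟩
    rintro rfl
    exact lt_irrefl _ h
  | zero => exact zero_mem _
  | add x y _ _ hx hy => exact add_mem (hx (by omega)) (hy (by omega))

theorem mem_semigroup (i : Fin m) : d i ∈ semigroup d :=
  AddSubmonoid.subset_closure (Set.mem_range_self i)

theorem natCast_mem_intSet {S : AddSubmonoid ℕ} {s : ℕ} : (s : ℤ) ∈ intSet S ↔ s ∈ S := by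
  simp [intSet]

theorem add_mem_intSet {S : AddSubmonoid ℕ} {x y : ℤ} (hx : x ∈ intSet S) (hy : y ∈ intSet S) :
    x + y ∈ intSet S := by
  obtain ⟨s, hs, rfl⟩ := hx
  obtain ⟨t, ht, rfl⟩ := hy
  exact ⟨s + t, add_mem hs ht, by push_cast; rfl⟩

theorem nonneg_of_mem_intSet {S : AddSubmonoid ℕ} {x : ℤ} (hx : x ∈ intSet S) : 0 ≤ x := by
  obtain ⟨s, _, rfl⟩ := hx
  omega

theorem zero_mem_intSet (S : AddSubmonoid ℕ) : (0 : ℤ) ∈ intSet S := ⟨0, zero_mem _, rfl⟩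

/-- A generator is not the sum of another generator and an element of the semigroup. -/
theorem IsMinimalGenerators.eq_of_sub_mem (hd : IsMinimalGenerators d) {i j : Fin m}
    (h : (d i : ℤ) - d j ∈ intSet (semigroup d)) : i = j := by
  obtain ⟨s, hs, hs'⟩ := h
  by_contra hne
  have hj := hd.pos j
  have hi : d i = d j + s := by omega
  refine hd.minimal i ?_
  have h1 : d j ∈ AddSubmonoid.closure (d '' {i}ᶜ) :=
    AddSubmonoid.subset_closure ⟨j, Ne.symm hne, rfl⟩
  have h2 := add_mem h1 (mem_closure_of_lt (i := i) hs (by omega))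
  rwa [← hi] at h2

variable [NeZero m]

/-- The least element of the semigroup in the residue class of `d i` modulo `d 0`. -/
def aperyElement (d : Fin m → ℕ) (i : Fin m) : ℕ := if i = 0 then 0 else d i

theorem aperyElement_mem (i : Fin m) : aperyElement d i ∈ semigroup d := by
  rw [aperyElement]
  split_ifs
  · exact zero_mem _
  · exact mem_semigroup i

theorem IsMinimalGenerators.aperyElement_injective_mod (hd : IsMinimalGenerators d) {i j : Fin m}
    (h : aperyElement d i % d 0 = aperyElement d j % d 0) : i = j := by
  wlog hij : aperyElement d i ≤ aperyElement d j generalizing i j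
  · exact (this h.symm (le_of_not_ge hij)).symm
  by_contra hne
  obtain ⟨t, ht⟩ := (Nat.modEq_iff_dvd' hij).mp h
  have hj0 : j ≠ 0 := by
    rintro rfl
    have h1 : aperyElement d (0 : Fin m) = 0 := if_pos rfl
    have h2 : aperyElement d i = d i := if_neg hne
    have := hd.pos i
    omega
  have hj : aperyElement d j = d j := if_neg hj0
  refine hj0 ?_
  -- The two elements differ by t times d 0. If t = 0 they coincide; if t > 0 then d j - d 0 lies in
  -- S. Both contradict minimality of the generators.
  rcases eq_or_ne t 0 with rfl | ht0
  · by_cases hi0 : i = 0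
    · have h1 : aperyElement d i = 0 := if_pos hi0
      have := hd.pos j
      omega
    · have h1 : aperyElement d i = d i := if_neg hi0
      exact absurd (hd.strictMono.injective (by omega)) hne
  · refine hd.eq_of_sub_mem (i := j) (j := 0) ⟨aperyElement d i + (t - 1) * d 0,
      add_mem (aperyElement_mem i) ?_, ?_⟩
    · rw [← smul_eq_mul]
      exact nsmul_mem (mem_semigroup 0) _
    · obtain ⟨u, rfl⟩ := Nat.exists_eq_add_one_of_ne_zero ht0
      have : aperyElement d j = aperyElement d i + d 0 * (u + 1) := by omega
      rw [hj] at this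
      rw [this, Nat.add_sub_cancel]
      push_cast
      ring

/-- Pigeonhole: the m Apéry elements are pairwise incongruent modulo m, so they meet every residue
class. -/
theorem IsMinimalGenerators.exists_modEq (hd : IsMinimalGenerators d) (hm : d 0 = m) (x : ℤ) :
    ∃ i, x ≡ aperyElement d i [ZMOD m] := by
  have hinj : Function.Injective
      fun i : Fin m => (⟨aperyElement d i % m, Nat.mod_lt _ (NeZero.pos m)⟩ : Fin m) := by
    intro i j h
    refine hd.aperyElement_injective_mod ?_
    rw [hm]
    exact congrArg Fin.val h
  have h0 : (0 : ℤ) < m := by exact_mod_cast NeZero.pos m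
  have h1 := Int.emod_nonneg x h0.ne'
  have h2 := Int.emod_lt_of_pos x h0
  obtain ⟨i, hi⟩ := Finite.surjective_of_injective hinj ⟨(x % m).toNat, by omega⟩
  refine ⟨i, ?_⟩
  have h3 := congrArg Fin.val hi
  simp only at h3
  rw [Int.ModEq, ← Int.natCast_mod, h3]
  omega

/-- In the inductive step, x and y dominate the Apéry elements of their classes. If the sum of those
two were below d i in the class of x + y, then d i - d 0 would lie in S, against minimality. -/
theorem IsMinimalGenerators.aperyElement_le (hd : IsMinimalGenerators d) (hm : d 0 = m) {s : ℕ}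
    (hs : s ∈ semigroup d) (i : Fin m) (h : s % m = aperyElement d i % m) :
    aperyElement d i ≤ s := by
  have hinj : ∀ {i j : Fin m}, aperyElement d i % m = aperyElement d j % m → i = j := by
    exact fun h => hd.aperyElement_injective_mod (by rwa [hm])
  have h00 : aperyElement d (0 : Fin m) = 0 := if_pos rfl
  induction hs using AddSubmonoid.closure_induction generalizing i with
  | mem x hx =>
    obtain ⟨j, rfl⟩ := hx
    by_cases hj : j = 0
    · subst hj
      have : i = 0 := hinj (by rw [← h, h00, hm]; simp)
      rw [this, h00]
      omega
    · have hj' : aperyElement d j = d j := if_neg hj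
      rw [← hinj (i := j) (j := i) (by rw [hj', h]), hj']
  | zero =>
    rw [← hinj (i := 0) (j := i) (by rw [h00, h]), h00]
  | add x y hx' hy' hx hy =>
    obtain ⟨a, ha⟩ := hd.exists_modEq hm x
    obtain ⟨b, hb⟩ := hd.exists_modEq hm y
    rw [Int.natCast_modEq_iff] at ha hb
    have h1 := hx a ha
    have h2 := hy b hb
    have hab : (aperyElement d a + aperyElement d b) % m = aperyElement d i % m := by
      rw [← h]
      exact (Nat.ModEq.add ha hb).symm
    by_contra hlt
    have hlt' : aperyElement d a + aperyElement d b < aperyElement d i := by omega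
    obtain ⟨t, ht⟩ := (Nat.modEq_iff_dvd' hlt'.le).mp hab
    by_cases hi : i = 0
    · subst hi
      omega
    have hi' : aperyElement d i = d i := if_neg hi
    have ht0 : t ≠ 0 := by
      rintro rfl
      omega
    refine hi (hd.eq_of_sub_mem (i := i) (j := 0)
      ⟨aperyElement d a + aperyElement d b + (t - 1) * d 0,
      add_mem (add_mem (aperyElement_mem a) (aperyElement_mem b)) ?_, ?_⟩)
    · rw [← smul_eq_mul]
      exact nsmul_mem (mem_semigroup 0) _
    · obtain ⟨u, rfl⟩ := Nat.exists_eq_add_one_of_ne_zero ht0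
      have : aperyElement d i = aperyElement d a + aperyElement d b + d 0 * (u + 1) := by
        rw [hm]
        omega
      rw [hi'] at this
      rw [this, Nat.add_sub_cancel]
      push_cast
      ring

/-- Membership in a numerical semigroup of maximal embedding dimension. -/
theorem IsMinimalGenerators.mem_intSet_iff (hd : IsMinimalGenerators d) (hm : d 0 = m) {x : ℤ}
    {i : Fin m} (h : x ≡ aperyElement d i [ZMOD m]) :
    x ∈ intSet (semigroup d) ↔ (aperyElement d i : ℤ) ≤ x := by
  constructor
  · rintro ⟨s, hs, rfl⟩
    rw [Int.natCast_modEq_iff] at h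
    exact_mod_cast hd.aperyElement_le hm hs i h
  · intro hle
    obtain ⟨t, ht⟩ := h.symm.dvd
    have h0 : (0 : ℤ) < m := by exact_mod_cast NeZero.pos m
    have ht0 : 0 ≤ t := by
      by_contra hneg
      have : (m : ℤ) * t < 0 := mul_neg_of_pos_of_neg h0 (by omega)
      omega
    lift t to ℕ using ht0
    refine ⟨aperyElement d i + t • d 0,
      add_mem (aperyElement_mem i) (nsmul_mem (mem_semigroup 0) _), ?_⟩
    rw [hm, smul_eq_mul]
    push_cast
    linarith

/-- The Apéry set with respect to the multiplicity consists of `0` and the other generators. -/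
theorem IsMinimalGenerators.eq_zero_or_exists_eq (hd : IsMinimalGenerators d) (hm : d 0 = m)
    {x : ℤ} (h : x ∈ intSet (semigroup d)) (h' : x - m ∉ intSet (semigroup d)) :
    x = 0 ∨ ∃ i ≠ 0, x = d i := by
  obtain ⟨i, hi⟩ := hd.exists_modEq hm x
  have hi' : x - m ≡ aperyElement d i [ZMOD m] := by
    refine Int.ModEq.trans ?_ hi
    rw [Int.modEq_iff_dvd]
    exact ⟨1, by ring⟩
  rw [hd.mem_intSet_iff hm hi] at h
  rw [hd.mem_intSet_iff hm hi'] at h'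
  obtain ⟨t, ht⟩ := hi.symm.dvd
  have h0 : (0 : ℤ) < m := by exact_mod_cast NeZero.pos m
  have ht0 : t = 0 := by
    have h1 : (m : ℤ) * t < m * 1 := by linarith
    have h2 : (m : ℤ) * t > m * (-1) := by linarith
    have := lt_of_mul_lt_mul_left h1 h0.le
    have := lt_of_mul_lt_mul_left h2 h0.le
    omega
  rw [ht0, mul_zero] at ht
  by_cases hi0 : i = 0
  · have : aperyElement d i = 0 := if_pos hi0
    exact Or.inl (by omega)
  · have : aperyElement d i = d i := if_neg hi0
    exact Or.inr ⟨i, hi0, by omega⟩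

end MaximalEmbeddingDimension

/-! ### Koszul cycles of the semigroup ring. -/

section SemigroupRing

open Classical

variable {m : ℕ} {d : Fin m → ℕ}

/-- The graded pieces of the semigroup ring, with all nonzero pieces identified with `k`. -/
noncomputable def semigroupPart (k : Type*) [Field k] (d : Fin m → ℕ) (n : ℤ) : Submodule k k :=
  if n ∈ intSet (semigroup d) then ⊤ else ⊥

variable {k : Type*} [Field k]

theorem mem_pi_ite {ι : Type*} (p : ι → Prop) [DecidablePred p] (w : ι → k) :
    w ∈ (Submodule.pi Set.univ fun i => if p i then (⊤ : Submodule k k) else ⊥ :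
      Submodule k (ι → k)) ↔ ∀ i, ¬ p i → w i = 0 := by
  simp only [Submodule.mem_pi, Set.mem_univ, forall_true_left]
  refine forall_congr' fun i => ?_
  by_cases h : p i
  · rw [if_pos h]
    simp [h]
  · rw [if_neg h, Submodule.mem_bot]
    simp [h]

theorem mem_koszulStrand_semigroupPart {i : ℕ} {n : ℤ} {f : Finset (Fin m) → k} :
    f ∈ koszulStrand d (semigroupPart k d) i n ↔
      ∀ J, ¬ (J.card = i ∧ n - ∑ j ∈ J, (d j : ℤ) ∈ intSet (semigroup d)) → f J = 0 := by
  rw [mem_koszulStrand]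
  constructor
  · rintro ⟨h1, h2⟩ J hJ
    by_cases hi : J.card = i
    · have := h1 J hi
      rw [semigroupPart, if_neg fun h => hJ ⟨hi, h⟩] at this
      exact this
    · exact h2 J hi
  · refine fun h => ⟨fun J hJ => ?_, fun J hJ => h J fun h => hJ h.1⟩
    rw [semigroupPart]
    split_ifs with hn
    · trivial
    · exact h J fun h => hn h.2

theorem finrank_koszulStrand_semigroupPart (i : ℕ) (n : ℤ) :
    Module.finrank k (koszulStrand d (semigroupPart k d) i n) =
      (Finset.univ.filter fun J : Finset (Fin m) =>
        J.card = i ∧ n - ∑ j ∈ J, (d j : ℤ) ∈ intSet (semigroup d)).card := by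
  rw [← finrank_pi_ite (k := k)]
  refine LinearEquiv.finrank_eq (LinearEquiv.ofEq _ _ ?_)
  ext f
  rw [mem_koszulStrand_semigroupPart, mem_pi_ite]

variable [NeZero m]

theorem koszul_id_of_zero_notMem {f : Finset (Fin m) → k} {J : Finset (Fin m)}
    (hJ : (0 : Fin m) ∉ J) :
    koszul (fun _ : Fin m => (LinearMap.id : k →ₗ[k] k)) f J =
      f (insert 0 J) + ∑ j ∈ (insert 0 J)ᶜ, koszulSign j J • f (insert j J) := by
  rw [koszul_apply, Finset.compl_insert,
    ← Finset.add_sum_erase _ _ (Finset.mem_compl.mpr hJ), koszulSign_of_lt fun i _ => Fin.zero_le i,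
    one_smul]
  rfl

/-- The Koszul cycles of the semigroup ring are determined by their coefficients at the sets that
do not contain the least generator. -/
theorem finrank_koszulCycles_semigroupPart (hd : IsMinimalGenerators d) (hm : d 0 = m) (i : ℕ)
    (n : ℤ) :
    Module.finrank k (koszulCycles d (fun _ => LinearMap.id) (semigroupPart k d) (i + 1) n) =
      (Finset.univ.filter fun J : Finset (Fin m) => (J.card = i + 1 ∧ 0 ∉ J) ∧
        n - ∑ j ∈ J, (d j : ℤ) ∈ intSet (semigroup d) ∧ n - ∑ j ∈ J, (d j : ℤ) ≠ 0).card := by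
  rw [← finrank_pi_ite (k := k)]
  -- ρ forgets the coefficients at sets containing 0. It is injective on cycles because the cycle
  -- equation at J \ {0} expresses the coefficient at J through coefficients at sets omitting 0.
  let ρ : (Finset (Fin m) → k) →ₗ[k] (Finset (Fin m) → k) :=
    LinearMap.pi fun J => if 0 ∈ J then 0 else LinearMap.proj J
  have ρ_mem : ∀ (f : Finset (Fin m) → k) {J}, 0 ∈ J → ρ f J = 0 := by
    intro f J hJ
    simp [ρ, hJ]
  have ρ_notMem : ∀ (f : Finset (Fin m) → k) {J}, 0 ∉ J → ρ f J = f J := by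
    intro f J hJ
    simp [ρ, hJ]
  have hA : IsGradedAction d (fun _ => LinearMap.id) (semigroupPart k d) := by
    intro i n v hv
    rw [semigroupPart] at hv ⊢
    split_ifs at hv with h
    · rw [if_pos (add_mem_intSet h (natCast_mem_intSet.mpr (mem_semigroup i)))]
      trivial
    · rw [Submodule.mem_bot] at hv
      rw [hv]
      exact zero_mem _
  have e := finrank_map_add_finrank_inf_ker ρ
    (koszulCycles d (fun _ => LinearMap.id) (semigroupPart k d) (i + 1) n)
  have h1 : koszulCycles d (fun _ => LinearMap.id) (semigroupPart k d) (i + 1) n ⊓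
      LinearMap.ker ρ = ⊥ := by
    rw [eq_bot_iff]
    rintro f ⟨⟨_, hf⟩, hρ⟩
    have h0 : ∀ J, 0 ∉ J → f J = 0 := fun J hJ => by
      rw [← ρ_notMem f hJ]
      exact congrFun hρ J
    rw [Submodule.mem_bot]
    funext J
    by_cases hJ : 0 ∈ J
    · have h2 := congrFun hf (J.erase 0)
      rw [koszul_id_of_zero_notMem (Finset.notMem_erase 0 J), Finset.insert_erase hJ,
        Finset.sum_eq_zero, add_zero] at h2
      · exact h2
      · intro j hj
        rw [h0, smul_zero]
        rw [Finset.mem_compl] at hj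
        rw [Finset.mem_insert, not_or]
        refine ⟨?_, Finset.notMem_erase 0 J⟩
        rintro rfl
        exact hj hJ
    · exact h0 J hJ
  rw [h1, finrank_bot, add_zero] at e
  rw [← e]
  refine LinearEquiv.finrank_eq (LinearEquiv.ofEq _ _ ?_)
  apply le_antisymm
  · rintro _ ⟨f, ⟨hf, hf'⟩, rfl⟩
    rw [SetLike.mem_coe, mem_koszulStrand_semigroupPart] at hf
    rw [mem_pi_ite]
    intro J hJ
    by_cases h0 : 0 ∈ J
    · exact ρ_mem f h0
    rw [ρ_notMem f h0]
    by_cases hJ' : J.card = i + 1 ∧ n - ∑ j ∈ J, (d j : ℤ) ∈ intSet (semigroup d)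
    · have hn : n - ∑ j ∈ J, (d j : ℤ) = 0 := by
        by_contra hn
        exact hJ ⟨⟨hJ'.1, h0⟩, hJ'.2, hn⟩
      obtain ⟨l, hl⟩ : J.Nonempty := by
        rw [← Finset.card_pos]
        omega
      have h2 := congrFun hf' (J.erase l)
      rw [koszul_apply, Finset.sum_eq_single l] at h2
      · rw [Finset.insert_erase hl] at h2
        have h3 := congrArg (fun y => koszulSign l (J.erase l) • y) h2
        simpa only [smul_smul, koszulSign_mul_self, one_smul, Pi.zero_apply, smul_zero,
          LinearMap.id_apply] using h3
      · intro j hj hjl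
        rw [Finset.mem_compl] at hj
        rw [hf, map_zero, smul_zero]
        rintro ⟨_, h4⟩
        rw [Finset.sum_insert hj] at h4
        have h5 := Finset.add_sum_erase J (fun j => (d j : ℤ)) hl
        refine hjl (hd.eq_of_sub_mem (i := l) (j := j) ?_).symm
        convert h4 using 1
        linarith
      · intro h
        simp at h
    · exact hf J hJ'
  · intro g hg
    rw [mem_pi_ite] at hg
    have hg0 : ∀ J, 0 ∈ J → g J = 0 := fun J hJ => hg J fun h => h.1.2 hJ
    -- The coefficients at sets containing 0 are solved for from the cycle equations at sets
    -- omitting 0.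
    let f : Finset (Fin m) → k := fun J => if 0 ∈ J then
      -∑ j ∈ Jᶜ, koszulSign j (J.erase 0) • g (insert j (J.erase 0)) else g J
    have f_notMem : ∀ {J}, 0 ∉ J → f J = g J := fun hJ => if_neg hJ
    have hcycle : koszul (fun _ : Fin m => (LinearMap.id : k →ₗ[k] k)) f = 0 := by
      have h2 : ∀ J, 0 ∉ J → koszul (fun _ : Fin m => (LinearMap.id : k →ₗ[k] k)) f J = 0 := by
        intro J hJ
        rw [koszul_id_of_zero_notMem hJ]
        simp only [f, Finset.mem_insert_self, if_true, Finset.erase_insert hJ]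
        rw [neg_add_eq_zero]
        refine Finset.sum_congr rfl fun j hj => ?_
        rw [Finset.mem_compl, Finset.mem_insert, not_or] at hj
        rw [if_neg]
        simp [hJ, Ne.symm hj.1]
      funext J
      by_cases hJ : 0 ∈ J
      -- The remaining cycle equations are automatic: in ∂²f = 0 at J \ {0} only the term inserting
      -- 0 survives, and it is the boundary of f at J.
      · have h3 := congrFun (koszul_koszul (x := fun _ : Fin m => (LinearMap.id : k →ₗ[k] k))
          (fun _ _ _ => rfl) f) (J.erase 0)
        rw [koszul_id_of_zero_notMem (Finset.notMem_erase 0 J), Finset.insert_erase hJ,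
          Finset.sum_eq_zero, add_zero] at h3
        · exact h3
        · intro j hj
          rw [h2, smul_zero]
          rw [Finset.mem_compl] at hj
          rw [Finset.mem_insert, not_or]
          refine ⟨?_, Finset.notMem_erase 0 J⟩
          rintro rfl
          exact hj hJ
      · exact h2 J hJ
    refine ⟨f, ⟨?_, hcycle⟩, ?_⟩
    · rw [SetLike.mem_coe, mem_koszulStrand_semigroupPart]
      intro J hJ
      by_cases h0 : 0 ∈ J
      · simp only [f, h0, if_true, neg_eq_zero]
        refine Finset.sum_eq_zero fun j hj => ?_
        rw [Finset.mem_compl] at hj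
        have hj' : j ∉ J.erase 0 := fun h => hj (Finset.mem_of_mem_erase h)
        rw [hg, smul_zero]
        rintro ⟨⟨h2, h3⟩, h4, h5⟩
        rw [Finset.card_insert_of_notMem hj', Finset.card_erase_of_mem h0] at h2
        rw [Finset.sum_insert hj'] at h4 h5
        have h6 := Finset.add_sum_erase J (fun j => (d j : ℤ)) h0
        simp only [hm] at h6
        have hdj := hd.pos j
        have hcard := Finset.card_pos.mpr ⟨0, h0⟩
        have h7 : n - ∑ j ∈ J.erase 0, (d j : ℤ) ∈ intSet (semigroup d) := by
          convert add_mem_intSet h4 (natCast_mem_intSet.mpr (mem_semigroup j)) using 1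
          ring
        -- If J were not admissible, x = n - Σ over J \ {0} would lie in S with x - m outside S, so
        -- x would be 0 or a generator. But x - d j is a nonzero element of S, which excludes both.
        rcases hd.eq_zero_or_exists_eq hm h7 fun h => hJ ⟨by omega, by convert h using 1; linarith⟩
          with h8 | ⟨l, hl, h8⟩
        · have := nonneg_of_mem_intSet h4
          omega
        · have : l = j := hd.eq_of_sub_mem (by
            convert h4 using 1
            linarith)
          subst this
          exact h5 (by linarith)
      · rw [f_notMem h0]
        exact hg J fun h => hJ ⟨h.1.1, h.2.1⟩
    · funext J
      by_cases h0 : 0 ∈ J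
      · rw [ρ_mem f h0, hg0 J h0]
      · rw [ρ_notMem f h0, f_notMem h0]

end SemigroupRing

/-! ### The multisets of syzygy degrees. -/

section Degrees

open Classical

variable {m : ℕ} [NeZero m] {d : Fin m → ℕ} {k : Type*} [Field k]

/-- The multiset of the sums of `i` generators with distinct indices, other than the least one. -/
def tailSums (d : Fin m → ℕ) (i : ℕ) : Multiset ℤ :=
  (Finset.powersetCard i (Finset.univ.erase (0 : Fin m))).val.map fun J => ∑ j ∈ J, (d j : ℤ)

theorem card_filter_zero_mem (d : Fin m → ℕ) (hm : d 0 = m) (Q : ℤ → Prop) (i : ℕ) (n : ℤ) :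
    (Finset.univ.filter fun J : Finset (Fin m) =>
      (J.card = i + 1 ∧ 0 ∈ J) ∧ Q (n - ∑ j ∈ J, (d j : ℤ))).card =
    (Finset.univ.filter fun J : Finset (Fin m) =>
      (J.card = i ∧ 0 ∉ J) ∧ Q (n - ∑ j ∈ J, (d j : ℤ) - m)).card := by
  refine Finset.card_nbij' (fun J => J.erase 0) (fun J => insert 0 J) ?_ ?_ ?_ ?_
  · intro J hJ
    simp only [Finset.coe_filter, Finset.mem_univ, true_and, Set.mem_ofPred_eq] at hJ ⊢
    refine ⟨⟨by rw [Finset.card_erase_of_mem hJ.1.2]; omega, Finset.notMem_erase 0 J⟩, ?_⟩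
    have h := Finset.add_sum_erase J (fun j => (d j : ℤ)) hJ.1.2
    simp only [hm] at h
    convert hJ.2 using 1
    linarith
  · intro J hJ
    simp only [Finset.coe_filter, Finset.mem_univ, true_and, Set.mem_ofPred_eq] at hJ ⊢
    refine ⟨⟨by rw [Finset.card_insert_of_notMem hJ.1.2]; omega, Finset.mem_insert_self 0 J⟩, ?_⟩
    rw [Finset.sum_insert hJ.1.2, hm]
    convert hJ.2 using 1
    ring
  · intro J hJ
    simp only [Finset.coe_filter, Finset.mem_univ, true_and, Set.mem_ofPred_eq] at hJ
    exact Finset.insert_erase hJ.1.2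
  · intro J hJ
    simp only [Finset.coe_filter, Finset.mem_univ, true_and, Set.mem_ofPred_eq] at hJ
    exact Finset.erase_insert hJ.1.2

theorem tailSums_one (d : Fin m → ℕ) :
    tailSums d 1 = (Finset.univ.erase (0 : Fin m)).val.map fun j => (d j : ℤ) := by
  rw [tailSums, Finset.powersetCard_one, Finset.map_val, Multiset.map_map]
  simp only [Function.comp_def, Function.Embedding.coeFn_mk, Finset.sum_singleton]

theorem count_tailSums (d : Fin m → ℕ) (i : ℕ) (n : ℤ) : (tailSums d i).count n =
    (Finset.univ.filter fun J : Finset (Fin m) =>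
      (J.card = i ∧ 0 ∉ J) ∧ n - ∑ j ∈ J, (d j : ℤ) = 0).card := by
  rw [tailSums, Multiset.count_map, ← Finset.filter_val, Finset.card_val]
  congr 1
  ext J
  simp only [Finset.mem_filter, Finset.mem_powersetCard, Finset.mem_univ, true_and,
    Finset.subset_erase, Finset.subset_univ, sub_eq_zero]
  tauto

/-- Distinct generators have distinct values, so J and n determine the index l, and pairs (J, l) may
be counted by J alone. -/
theorem count_joinSumset_tailSums (hinj : Function.Injective d) (i : ℕ) (n : ℤ) :
    (joinSumset (tailSums d i) (tailSums d 1)).count n =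
    (Finset.univ.filter fun J : Finset (Fin m) =>
      (J.card = i ∧ 0 ∉ J) ∧ ∃ l ≠ 0, n - ∑ j ∈ J, (d j : ℤ) = d l).card := by
  have h2 : joinSumset (tailSums d i) (tailSums d 1) =
      ((Finset.powersetCard i (Finset.univ.erase (0 : Fin m))) ×ˢ
        (Finset.univ.erase (0 : Fin m))).val.map fun p => ∑ j ∈ p.1, (d j : ℤ) + d p.2 := by
    rw [tailSums_one, joinSumset, tailSums, Finset.product_val]
    simp only [SProd.sprod, Multiset.product, Multiset.map_bind, Multiset.map_map,
      Multiset.bind_map, Function.comp_def]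
  rw [h2, Multiset.count_map, ← Finset.filter_val, Finset.card_val]
  refine Finset.card_nbij Prod.fst ?_ ?_ ?_
  · rintro ⟨J, l⟩ h
    simp only [Finset.mem_product, Finset.mem_powersetCard, Finset.subset_erase,
      Finset.mem_erase, Finset.mem_univ, and_true, true_and, Finset.coe_filter,
      Set.mem_ofPred_eq] at h ⊢
    exact ⟨⟨h.1.1.2, h.1.1.1.2⟩, l, h.1.2, by rw [h.2]; ring⟩
  · rintro ⟨J, l⟩ h ⟨J', l'⟩ h' (rfl : J = J')
    simp only [Finset.coe_filter, Set.mem_ofPred_eq] at h h'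
    have : (d l : ℤ) = d l' := by linarith [h.2, h'.2]
    rw [hinj (Int.natCast_inj.mp this)]
  · intro J h
    simp only [Finset.coe_filter, Finset.mem_univ, true_and, Set.mem_ofPred_eq] at h
    obtain ⟨⟨h1, h2⟩, l, hl, hn⟩ := h
    refine ⟨(J, l), ?_, rfl⟩
    simp only [Finset.mem_product, Finset.mem_powersetCard,
      Finset.subset_erase, Finset.mem_erase, Finset.mem_univ, and_true, Finset.coe_filter,
      Set.mem_ofPred_eq]
    exact ⟨⟨⟨⟨Finset.subset_univ J, h2⟩, h1⟩, hl⟩, by linarith⟩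

/-- The degrees of the syzygies of a semigroup ring of maximal embedding dimension. -/
theorem multB_add_tailSums (hd : IsMinimalGenerators d) (hm : d 0 = m)
    (P : MinimalResolution k d (semigroupIdeal k d)) (i : ℕ) :
    P.multB (i + 1) + tailSums d (i + 1 + 1) =
      joinSumset (tailSums d (i + 1)) (tailSums d 1) := by
  refine Multiset.ext.mpr fun n => ?_
  rw [Multiset.count_add, count_tailSums, count_joinSumset_tailSums hd.strictMono.injective,
    MinimalResolution.multB, Multiset.count_map, ← Finset.filter_val, Finset.card_val]
  -- The Betti number is Z_(i+1) + Z_(i+2) - C_(i+2), where Z and C are the dimensions of cycles and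
  -- chains. Below, C_(i+2) is split by whether 0 ∈ J and whether the residual degree is 0, and
  -- Z_(i+1) by whether m can still be subtracted inside S; all but two of the counts cancel.
  have e1 := P.card_filter_deg_eq hd.pos i n
  rw [P.map_augOne_freePart] at e1
  change _ = koszulBetti d (fun _ => LinearMap.id) (semigroupPart k d) (i + 1) n at e1
  rw [koszulBetti, finrank_koszulCycles_semigroupPart hd hm,
    finrank_koszulCycles_semigroupPart hd hm,
    finrank_koszulStrand_semigroupPart] at e1
  have e2 := card_filter_zero_mem d hm (· ∈ intSet (semigroup d)) (i + 1) n
  have e3 : (Finset.univ.filter fun J : Finset (Fin m) =>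
        J.card = i + 1 + 1 ∧ n - ∑ j ∈ J, (d j : ℤ) ∈ intSet (semigroup d)).card =
      (Finset.univ.filter fun J : Finset (Fin m) => (J.card = i + 1 + 1 ∧ 0 ∈ J) ∧
        n - ∑ j ∈ J, (d j : ℤ) ∈ intSet (semigroup d)).card +
      ((Finset.univ.filter fun J : Finset (Fin m) => (J.card = i + 1 + 1 ∧ 0 ∉ J) ∧
        n - ∑ j ∈ J, (d j : ℤ) ∈ intSet (semigroup d) ∧ n - ∑ j ∈ J, (d j : ℤ) ≠ 0).card +
      (Finset.univ.filter fun J : Finset (Fin m) => (J.card = i + 1 + 1 ∧ 0 ∉ J) ∧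
        n - ∑ j ∈ J, (d j : ℤ) = 0).card) := by
    rw [← Finset.card_union_of_disjoint, ← Finset.card_union_of_disjoint]
    · congr 1
      ext J
      simp only [Finset.mem_union, Finset.mem_filter, Finset.mem_univ, true_and]
      by_cases h0 : n - ∑ j ∈ J, (d j : ℤ) = 0
      · have := zero_mem_intSet (semigroup d)
        rw [h0]
        tauto
      · tauto
    · rw [Finset.disjoint_left]
      intro J
      simp only [Finset.mem_union, Finset.mem_filter, Finset.mem_univ, true_and]
      tauto
    · rw [Finset.disjoint_left]
      intro J
      simp only [Finset.mem_filter, Finset.mem_univ, true_and]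
      tauto
  have e4 : (Finset.univ.filter fun J : Finset (Fin m) => (J.card = i + 1 ∧ 0 ∉ J) ∧
        n - ∑ j ∈ J, (d j : ℤ) ∈ intSet (semigroup d) ∧ n - ∑ j ∈ J, (d j : ℤ) ≠ 0).card =
      (Finset.univ.filter fun J : Finset (Fin m) => (J.card = i + 1 ∧ 0 ∉ J) ∧
        n - ∑ j ∈ J, (d j : ℤ) - m ∈ intSet (semigroup d)).card +
      (Finset.univ.filter fun J : Finset (Fin m) => (J.card = i + 1 ∧ 0 ∉ J) ∧
        ∃ l ≠ 0, n - ∑ j ∈ J, (d j : ℤ) = d l).card := by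
    rw [← Finset.card_union_of_disjoint]
    · congr 1
      ext J
      simp only [Finset.mem_union, Finset.mem_filter, Finset.mem_univ, true_and, ← and_or_left]
      refine and_congr_right fun _ => ?_
      constructor
      · rintro ⟨h1, h2⟩
        by_cases h3 : n - ∑ j ∈ J, (d j : ℤ) - m ∈ intSet (semigroup d)
        · exact Or.inl h3
        · exact Or.inr ((hd.eq_zero_or_exists_eq hm h1 h3).resolve_left h2)
      · rintro (h | ⟨l, hl, h⟩)
        · have h0 := nonneg_of_mem_intSet h
          have h1 := NeZero.pos m
          refine ⟨?_, by omega⟩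
          have h2 : (m : ℤ) ∈ intSet (semigroup d) :=
            natCast_mem_intSet.mpr (by
              have := mem_semigroup (d := d) 0
              rwa [hm] at this)
          have h3 := add_mem_intSet h h2
          rwa [sub_add_cancel] at h3
        · rw [h]
          have := hd.pos l
          exact ⟨natCast_mem_intSet.mpr (mem_semigroup l), by omega⟩
    · rw [Finset.disjoint_left]
      intro J
      simp only [Finset.mem_filter, Finset.mem_univ, true_and]
      rintro ⟨_, h⟩ ⟨_, l, hl, h'⟩
      refine hl (hd.eq_of_sub_mem (i := l) (j := 0) ?_)
      rwa [← h', hm]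
  have e5 : (Finset.univ.filter fun l => n = (P.deg (i + 1) l : ℤ)) =
      Finset.univ.filter fun l => (P.deg (i + 1) l : ℤ) = n := by
    ext l
    simp [eq_comm]
  rw [e5]
  omega

end Degrees

/-! ### Pseudo-Frobenius numbers, F and Δ_H in terms of the generators. -/

section AlmostSymmetric

theorem map_frobenius_sub_gapsHFinset {m : ℕ} {d : Fin m → ℕ}
    (hd : IsMinimalGenerators d) :
    (gapsHFinset (semigroup d)).val.map (fun h => frobenius (semigroup d) - h) =
      (gapsHFinset (semigroup d)).val := by
  have h : (gapsHFinset (semigroup d)).image (fun h => frobenius (semigroup d) - h) =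
      gapsHFinset (semigroup d) := by
    ext x
    simp only [Finset.mem_image, mem_gapsHFinset hd.gcd_eq_one]
    constructor
    · rintro ⟨y, hy, rfl⟩
      exact ⟨hy.2, by rw [sub_sub_cancel]; exact hy.1⟩
    · intro hx
      exact ⟨frobenius (semigroup d) - x, ⟨hx.2, by rw [sub_sub_cancel]; exact hx.1⟩,
        sub_sub_cancel _ _⟩
  conv_rhs => rw [← h]
  rw [Finset.image_val_of_injOn]
  intro i _ j _ hij
  exact sub_right_injective hij

variable {m : ℕ} [NeZero m] {d : Fin m → ℕ}

/-- If x is pseudo-Frobenius, x + m is an Apéry element; it is not 0, since otherwise d l - m would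
lie in S. Conversely, if d i - m + s were outside S for some nonzero s in S, then d i + s would be a
nonzero Apéry element, that is, a generator, against minimality. -/
theorem IsMinimalGenerators.mem_pseudoFrobenius_iff (hd : IsMinimalGenerators d) (hm : d 0 = m)
    {l : Fin m} (hl : l ≠ 0) (x : ℤ) :
    x ∈ pseudoFrobenius (semigroup d) ↔ ∃ i ≠ 0, x = d i - m := by
  have hm0 : m ∈ semigroup d := by
    have := mem_semigroup (d := d) 0
    rwa [hm] at this
  constructor
  · rintro ⟨h1, h2⟩
    rcases hd.eq_zero_or_exists_eq hm (h2 m hm0 (NeZero.ne m)) (by rwa [add_sub_cancel_right])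
      with h | ⟨i, hi, h⟩
    · exfalso
      refine hl (hd.eq_of_sub_mem (i := l) (j := 0) ?_)
      convert h2 (d l) (mem_semigroup l) (hd.pos l).ne' using 1
      rw [hm]
      linarith
    · exact ⟨i, hi, by linarith⟩
  · rintro ⟨i, hi, rfl⟩
    refine ⟨fun h => hi (hd.eq_of_sub_mem (by rwa [hm])), fun s hs hs0 => ?_⟩
    by_contra h
    have h1 : (d i : ℤ) + s ∈ intSet (semigroup d) :=
      ⟨d i + s, add_mem (mem_semigroup i) hs, by push_cast; rfl⟩
    rcases hd.eq_zero_or_exists_eq hm h1 fun h' => h (by convert h' using 1; ring)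
      with h2 | ⟨j, _, h2⟩
    · omega
    · have : j = i := hd.eq_of_sub_mem ⟨s, hs, by linarith⟩
      subst this
      omega

/-- The largest Apéry element is the last generator d l. An integer outside S is below the Apéry
element of its class by at least m, so everything beyond d l - m is in S. -/
theorem IsMinimalGenerators.frobenius_eq (hd : IsMinimalGenerators d) (hm : d 0 = m)
    {l : Fin m} (hl : l ≠ 0) (hmax : ∀ i, i ≤ l) :
    frobenius (semigroup d) = d l - m := by
  have hlt : m < d l := by
    rw [← hm]
    exact hd.strictMono (Fin.pos_iff_ne_zero.mpr hl)
  have h1 : IsLeast {s : ℕ | s ∈ semigroup d ∧ ∀ n : ℕ, s + n ∈ semigroup d} (d l - m + 1) := by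
    have key : ∀ x : ℕ, d l - m + 1 ≤ x → x ∈ semigroup d := by
      intro x hx
      obtain ⟨i, hi⟩ := hd.exists_modEq hm x
      rw [← natCast_mem_intSet, hd.mem_intSet_iff hm hi]
      by_contra hlt'
      obtain ⟨t, ht⟩ := hi.dvd
      have h0 : (0 : ℤ) < m := by exact_mod_cast NeZero.pos m
      have ht0 : 0 < t := by
        by_contra hneg
        have : (m : ℤ) * t ≤ 0 := mul_nonpos_of_nonneg_of_nonpos h0.le (by omega)
        omega
      have h2 : (m : ℤ) * 1 ≤ m * t := by
        gcongr
        omega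
      have h3 : aperyElement d i ≤ d l := by
        rw [aperyElement]
        split_ifs
        · omega
        · exact hd.strictMono.monotone (hmax i)
      omega
    refine ⟨⟨key _ le_rfl, fun n => key _ (by omega)⟩, ?_⟩
    rintro s ⟨_, hs⟩
    by_contra hlt'
    have h2 := hs (d l - m - s)
    refine hl (hd.eq_of_sub_mem (i := l) (j := 0) ⟨_, h2, ?_⟩)
    omega
  rw [frobenius, conductor, h1.csInf_eq]
  omega

theorem IsMinimalGenerators.gapsHFinset_val (hd : IsMinimalGenerators d) (hm : d 0 = m)
    (hAS : IsAlmostSymmetric (semigroup d)) {l : Fin m} (hl : l ≠ 0) (hmax : ∀ i, i ≤ l) :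
    (gapsHFinset (semigroup d)).val =
      ((Finset.univ.erase (0 : Fin m)).erase l).val.map fun i => (d i : ℤ) - m := by
  have h : gapsHFinset (semigroup d) =
      ((Finset.univ.erase (0 : Fin m)).erase l).image fun i => (d i : ℤ) - m := by
    ext x
    rw [mem_gapsHFinset hd.gcd_eq_one, ← hAS, Set.mem_sdiff, hd.mem_pseudoFrobenius_iff hm hl,
      hd.frobenius_eq hm hl hmax, Set.mem_singleton_iff]
    simp only [Finset.mem_image, Finset.mem_erase, Finset.mem_univ, and_true]
    constructor
    · rintro ⟨⟨i, hi, rfl⟩, h⟩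
      refine ⟨i, ⟨?_, hi⟩, rfl⟩
      rintro rfl
      exact h rfl
    · rintro ⟨i, ⟨hil, hi⟩, rfl⟩
      refine ⟨⟨i, hi, rfl⟩, fun h => hil (hd.strictMono.injective ?_)⟩
      omega
  rw [h, Finset.image_val_of_injOn]
  intro i _ j _ hij
  refine hd.strictMono.injective ?_
  simp only at hij
  omega

end AlmostSymmetric

/-! ### Laurent polynomials as generating functions of multisets. -/

section GeneratingFunction

open LaurentPolynomial

/-- The generating function of a multiset of integers. -/
noncomputable def genFun : Multiset ℤ →+ LaurentPolynomial ℤ where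
  toFun A := (A.map fun a => T a).sum
  map_zero' := by simp
  map_add' A B := by simp

theorem genFun_apply (A : Multiset ℤ) : genFun A = (A.map fun a => (T a : ℤ[T;T⁻¹])).sum := rfl

theorem coeff_genFun (A : Multiset ℤ) (n : ℤ) : (genFun A).coeff n = A.count n := by
  induction A using Multiset.induction_on with
  | empty => simp [genFun_apply]
  | cons a A ih =>
    rw [← Multiset.singleton_add, map_add, AddMonoidAlgebra.coeff_add, Finsupp.add_apply, ih,
      Multiset.count_add, genFun_apply, Multiset.map_singleton, Multiset.sum_singleton, T_apply,
      Multiset.count_singleton]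
    push_cast
    simp [eq_comm]

theorem genFun_injective : Function.Injective genFun := by
  intro A B h
  refine Multiset.ext.mpr fun n => ?_
  have := congrArg (fun p => p.coeff n) h
  simp only [coeff_genFun] at this
  exact_mod_cast this

theorem genFun_joinSumset (A B : Multiset ℤ) :
    genFun (joinSumset A B) = genFun A * genFun B := by
  induction A using Multiset.induction_on with
  | empty =>
    rw [map_zero, zero_mul]
    simp [joinSumset, Multiset.zero_product]
  | cons a A ih =>
    have h : joinSumset (a ::ₘ A) B = B.map (fun b => a + b) + joinSumset A B := by
      rw [joinSumset, Multiset.cons_product, Multiset.map_add, Multiset.map_map]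
      rfl
    have h' : genFun (B.map fun b => a + b) = T a * genFun B := by
      rw [genFun_apply, genFun_apply, Multiset.map_map, ← Multiset.sum_map_mul_left]
      simp only [Function.comp_def, T_add]
    rw [h, map_add, ih, h', ← Multiset.singleton_add, map_add, add_mul]
    simp [genFun_apply]

theorem genFun_map_sub (A : Multiset ℤ) (c : ℤ) :
    genFun (A.map fun a => c - a) = T c * invert (genFun A) := by
  rw [genFun_apply, genFun_apply, Multiset.map_map, map_multiset_sum, Multiset.map_map,
    ← Multiset.sum_map_mul_left]
  simp only [Function.comp_def, invert_T, ← T_add, sub_eq_add_neg]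

theorem genFun_map_val {ι : Type*} (s : Finset ι) (f : ι → ℤ) :
    genFun (s.val.map f) = ∑ i ∈ s, T (f i) := by
  rw [genFun_apply, Multiset.map_map]
  rfl

theorem T_sum {ι : Type*} (s : Finset ι) (f : ι → ℤ) :
    (T (∑ i ∈ s, f i) : ℤ[T;T⁻¹]) = ∏ i ∈ s, T (f i) := by
  classical
  induction s using Finset.induction_on with
  | empty => simp
  | insert a s ha ih => rw [Finset.sum_insert ha, Finset.prod_insert ha, T_add, ih]

/-- The alternating sum of the generating functions of the sums of `i` distinct elements. -/
theorem sum_genFun_powersetCard {ι : Type*} (s : Finset ι) (f : ι → ℤ) :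
    ∑ i ∈ Finset.range (s.card + 1),
      (-1) ^ i * genFun ((s.powersetCard i).val.map fun J => ∑ j ∈ J, f j) =
    ∏ j ∈ s, (1 - T (f j)) := by
  classical
  simp only [sub_eq_add_neg]
  rw [Finset.prod_one_add, Finset.sum_powerset]
  refine Finset.sum_congr rfl fun i _ => ?_
  rw [genFun_map_val, Finset.mul_sum]
  refine Finset.sum_congr rfl fun J hJ => ?_
  rw [Finset.prod_neg, T_sum, (Finset.mem_powersetCard.mp hJ).2]

theorem invert_prod_one_sub {ι : Type*} (s : Finset ι) (f : ι → ℤ) :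
    invert (∏ j ∈ s, (1 - T (f j)) : ℤ[T;T⁻¹]) =
      (-1) ^ s.card * T (-∑ j ∈ s, f j) * ∏ j ∈ s, (1 - T (f j)) := by
  rw [map_prod, ← Finset.sum_neg_distrib, T_sum, ← Finset.prod_const, ← Finset.prod_mul_distrib,
    ← Finset.prod_mul_distrib]
  refine Finset.prod_congr rfl fun j _ => ?_
  rw [map_sub, map_one, invert_T]
  have : (T (-f j) : ℤ[T;T⁻¹]) * T (f j) = 1 := by rw [← T_add, neg_add_cancel, T_zero]
  linear_combination -this

theorem sum_neg_one_pow_mul {M : Type*} [CommRing M] (s : Finset ℕ) (f : ℕ → M) :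
    ∑ i ∈ s, (-1) ^ i * f i =
      ∑ i ∈ s.filter (fun i => Even i), f i - ∑ i ∈ s.filter (fun i => Odd i), f i := by
  rw [Finset.sum_filter, Finset.sum_filter, ← Finset.sum_sub_distrib]
  refine Finset.sum_congr rfl fun i _ => ?_
  rcases Nat.even_or_odd i with h | h
  · simp [h, h.neg_one_pow, Nat.not_odd_iff_even.mpr h]
  · simp [h, h.neg_one_pow, Nat.not_even_iff_odd.mpr h]

/-- Two pairs of multisets with the same difference and the same total cardinality have
intersections of the same cardinality. -/
theorem card_inter_eq_card_inter {α : Type*} [DecidableEq α] {X₁ X₂ M₁ M₂ : Multiset α}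
    (h : X₁ + M₁ = X₂ + M₂)
    (hcard : X₁.card + X₂.card = M₁.card + M₂.card) : (X₁ ∩ X₂).card = (M₁ ∩ M₂).card := by
  have h1 := congrArg Multiset.card h
  rw [Multiset.card_add, Multiset.card_add] at h1
  -- The two hypotheses also give |X₁| = |M₂|; subtracting the equal truncated differences leaves
  -- the intersections.
  have h2 : X₁ - X₂ = M₂ - M₁ := by
    refine Multiset.ext.mpr fun a => ?_
    have := congrArg (Multiset.count a) h
    rw [Multiset.count_add, Multiset.count_add] at this
    rw [Multiset.count_sub, Multiset.count_sub]
    omega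
  have h3 := congrArg Multiset.card (Multiset.sub_add_inter X₁ X₂)
  have h4 := congrArg Multiset.card (Multiset.sub_add_inter M₂ M₁)
  rw [Multiset.card_add] at h3 h4
  rw [Multiset.inter_comm M₂ M₁] at h4
  rw [h2] at h3
  omega

end GeneratingFunction

/-! ### Alternating sums of syzygy degrees and of sums of generators. -/

section AlmostSymmetricMED

open LaurentPolynomial

variable {k : Type*} [Field k] {m : ℕ} {d : Fin m → ℕ}

theorem genFun_multBbar (P : MinimalResolution k d (semigroupIdeal k d)) (i : ℕ) :
    genFun (P.multBbar i) =
      T (frobenius (semigroup d) + ∑ j, (d j : ℤ)) * invert (genFun (P.multB i)) :=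
  genFun_map_sub _ _

theorem genFun_multM₂_sub :
    genFun (multM₂ d) - genFun (multM₁ d) =
      (∑ i ∈ Finset.Ico 1 m, (-1) ^ i * genFun (genSums d i)) *
        genFun (gapsHFinset (semigroup d)).val := by
  rw [Finset.sum_mul]
  simp only [mul_assoc, ← genFun_joinSumset]
  rw [sum_neg_one_pow_mul, multM₁, multM₂, map_sum, map_sum]
  rfl

theorem invert_genFun_gapsHFinset (hd : IsMinimalGenerators d) :
    T (frobenius (semigroup d)) * invert (genFun (gapsHFinset (semigroup d)).val) =
      genFun (gapsHFinset (semigroup d)).val := by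
  rw [← genFun_map_sub, map_frobenius_sub_gapsHFinset hd]

variable [NeZero m]

theorem sum_range_eq_add_sum_Ico {M : Type*} [AddCommMonoid M] {m : ℕ} (hm : 2 ≤ m) (f : ℕ → M) :
    ∑ i ∈ Finset.range m, f i = f 0 + ∑ i ∈ Finset.Ico 1 (m - 1), f i + f (m - 1) := by
  obtain ⟨q, rfl⟩ := Nat.exists_eq_add_of_le' hm
  rw [Finset.sum_range_succ, Finset.range_eq_Ico, Finset.sum_eq_sum_Ico_succ_bot (by omega)]
  rfl

theorem tailSums_zero (d : Fin m → ℕ) : tailSums d 0 = {0} := by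
  simp [tailSums]

theorem card_univ_erase_zero : ((Finset.univ.erase (0 : Fin m)).card) = m - 1 := by
  rw [Finset.card_erase_of_mem (Finset.mem_univ _), Finset.card_univ, Fintype.card_fin]

theorem tailSums_sub_one (d : Fin m → ℕ) :
    tailSums d (m - 1) = {∑ j ∈ Finset.univ.erase (0 : Fin m), (d j : ℤ)} := by
  rw [tailSums, ← card_univ_erase_zero, Finset.powersetCard_self]
  rfl

theorem tailSums_of_le (d : Fin m → ℕ) {i : ℕ} (h : m ≤ i) : tailSums d i = 0 := by
  rw [tailSums, Finset.powersetCard_eq_empty.mpr]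
  · rfl
  · rw [card_univ_erase_zero]
    have := NeZero.pos m
    omega

theorem genFun_singleton (a : ℤ) : genFun {a} = T a := by
  simp [genFun_apply]

/-- The alternating sum of the generating functions of the syzygy degrees. -/
theorem sum_genFun_multB (hd : IsMinimalGenerators d) (hm : d 0 = m) (h2 : 2 ≤ m)
    (P : MinimalResolution k d (semigroupIdeal k d)) :
    ∑ i ∈ Finset.Ico 1 (m - 1), (-1) ^ i * genFun (P.multB i) =
      (∏ j ∈ Finset.univ.erase (0 : Fin m), (1 - T (d j : ℤ))) * genFun (tailSums d 1) +
      ∏ j ∈ Finset.univ.erase (0 : Fin m), (1 - T (d j : ℤ)) - 1 -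
      (-1) ^ (m - 1) * T (∑ j ∈ Finset.univ.erase (0 : Fin m), (d j : ℤ)) *
        genFun (tailSums d 1) := by
  have hE : ∑ i ∈ Finset.range m, (-1) ^ i * genFun (tailSums d i) =
      ∏ j ∈ Finset.univ.erase (0 : Fin m), (1 - T (d j : ℤ)) := by
    rw [← sum_genFun_powersetCard, card_univ_erase_zero, Nat.sub_add_cancel (NeZero.pos m)]
    rfl
  rw [← hE]
  set w := genFun (tailSums d 1) with hw
  -- Shifting the index changes the sign and drops the term 1 at index 0; no new term appears,
  -- because there are no m distinct generators other than the least.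
  have hshift : ∑ i ∈ Finset.range m, (-1) ^ i * genFun (tailSums d (i + 1)) =
      1 - ∑ i ∈ Finset.range m, (-1) ^ i * genFun (tailSums d i) := by
    have h := Finset.sum_range_succ' (fun i => (-1) ^ i * genFun (tailSums d i)) m
    rw [Finset.sum_range_succ, tailSums_of_le d le_rfl, tailSums_zero, genFun_singleton, T_zero,
      map_zero] at h
    have h' : ∑ i ∈ Finset.range m, (-1) ^ (i + 1) * genFun (tailSums d (i + 1)) =
        -∑ i ∈ Finset.range m, (-1) ^ i * genFun (tailSums d (i + 1)) := by
      rw [← Finset.sum_neg_distrib]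
      refine Finset.sum_congr rfl fun i _ => ?_
      ring
    rw [h'] at h
    linear_combination h
  have hB : ∑ i ∈ Finset.Ico 1 (m - 1), (-1) ^ i * genFun (P.multB i) =
      ∑ i ∈ Finset.Ico 1 (m - 1),
        (-1) ^ i * (genFun (tailSums d i) * w - genFun (tailSums d (i + 1))) := by
    refine Finset.sum_congr rfl fun i hi => ?_
    obtain ⟨j, rfl⟩ := Nat.exists_eq_add_of_le' (Finset.mem_Ico.mp hi).1
    have h := congrArg genFun (multB_add_tailSums hd hm P j)
    rw [map_add, genFun_joinSumset] at h
    rw [hw, ← h]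
    ring
  -- Extending the range to all i < m adds nothing at i = 0, where w - w = 0, and adds the
  -- correction (-1)^(m-1) T^(s') w at i = m - 1.
  have hfull := sum_range_eq_add_sum_Ico h2 fun i =>
    (-1) ^ i * (genFun (tailSums d i) * w - genFun (tailSums d (i + 1)))
  rw [← hB, tailSums_sub_one, Nat.sub_add_cancel (NeZero.pos m), tailSums_of_le d le_rfl,
    tailSums_zero, genFun_singleton, genFun_singleton, T_zero, map_zero, ← hw] at hfull
  simp only [mul_sub, Finset.sum_sub_distrib] at hfull
  rw [hshift] at hfull
  have hmul : ∑ i ∈ Finset.range m, (-1) ^ i * (genFun (tailSums d i) * w) =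
      (∑ i ∈ Finset.range m, (-1) ^ i * genFun (tailSums d i)) * w := by
    rw [Finset.sum_mul]
    refine Finset.sum_congr rfl fun i _ => ?_
    ring
  rw [hmul] at hfull
  linear_combination -hfull

/-- The alternating sum of the generating functions of the sums of generators. -/
theorem sum_genFun_genSums (hm : d 0 = m) :
    ∑ i ∈ Finset.Ico 1 m, (-1) ^ i * genFun (genSums d i) =
      (1 - T (m : ℤ)) * ∏ j ∈ Finset.univ.erase (0 : Fin m), (1 - T (d j : ℤ)) - 1 +
      (-1) ^ (m - 1) * (T (m : ℤ) * T (∑ j ∈ Finset.univ.erase (0 : Fin m), (d j : ℤ))) := by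
  have hm1 := NeZero.pos m
  have h := sum_genFun_powersetCard (Finset.univ : Finset (Fin m)) fun j => (d j : ℤ)
  rw [Finset.card_univ, Fintype.card_fin, ← Finset.mul_prod_erase _ _ (Finset.mem_univ 0), hm] at h
  rw [← h, sum_range_eq_add_sum_Ico (by omega : 2 ≤ m + 1), Nat.add_sub_cancel]
  have h0 : genFun (genSums d 0) = 1 := by
    simp [genSums, genFun_singleton]
  have hlast : genFun (genSums d m) =
      T (m : ℤ) * T (∑ j ∈ Finset.univ.erase (0 : Fin m), (d j : ℤ)) := by
    have h1 : (Finset.univ : Finset (Fin m)).powersetCard m = {Finset.univ} := by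
      have := Finset.powersetCard_self (Finset.univ : Finset (Fin m))
      rwa [Finset.card_univ, Fintype.card_fin] at this
    have hs := Finset.add_sum_erase _ (fun j => (d j : ℤ)) (Finset.mem_univ 0)
    rw [hm] at hs
    rw [genSums, h1, ← T_add, hs, genFun_map_val, Finset.sum_singleton]
  change _ = (-1) ^ 0 * genFun (genSums d 0) +
    ∑ i ∈ Finset.Ico 1 m, (-1) ^ i * genFun (genSums d i) + (-1) ^ m * genFun (genSums d m) - 1 + _
  rw [h0, hlast]
  have hpow : ((-1) ^ m : ℤ[T;T⁻¹]) = -(-1) ^ (m - 1) := by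
    conv_lhs => rw [← Nat.sub_add_cancel hm1, pow_succ]
    ring
  rw [hpow]
  ring

/-- The generating functions of `X_2 - X_1` and of the alternating sum of the multisets of syzygy
degrees and their conjugates. -/
theorem genFun_multX₂_sub (P : MinimalResolution k d (semigroupIdeal k d)) :
    genFun P.multX₂ - genFun P.multX₁ =
      ∑ i ∈ Finset.Ico 1 (m - 1), (-1) ^ i * genFun (P.multB i) -
      (-1) ^ (m - 1) * (T (frobenius (semigroup d) + ∑ j, (d j : ℤ)) *
        invert (∑ i ∈ Finset.Ico 1 (m - 1), (-1) ^ i * genFun (P.multB i))) := by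
  have hbar : T (frobenius (semigroup d) + ∑ j, (d j : ℤ)) *
      invert (∑ i ∈ Finset.Ico 1 (m - 1), (-1) ^ i * genFun (P.multB i)) =
      ∑ i ∈ Finset.Ico 1 (m - 1), (-1) ^ i * genFun (P.multBbar i) := by
    rw [map_sum, Finset.mul_sum]
    refine Finset.sum_congr rfl fun i _ => ?_
    rw [genFun_multBbar, map_mul, map_pow, map_neg, map_one]
    ring
  rw [hbar, sum_neg_one_pow_mul, sum_neg_one_pow_mul]
  simp only [← map_sum genFun]
  change _ = genFun P.multBe - genFun P.multBo -
    (-1) ^ (m - 1) * (genFun P.multBeBar - genFun P.multBoBar)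
  -- The case split on the parity of m in X_1 and X_2 is exactly the sign (-1)^m of the conjugate
  -- alternating sum.
  have hpow : ((-1) ^ (m - 1) : ℤ[T;T⁻¹]) = -(-1) ^ m := by
    conv_rhs => rw [← Nat.sub_add_cancel (NeZero.pos m), pow_succ]
    ring
  rw [hpow, MinimalResolution.multX₁, MinimalResolution.multX₂]
  by_cases h : Even m
  · rw [if_pos h, if_pos h, h.neg_one_pow, map_add, map_add]
    ring
  · rw [if_neg h, if_neg h, (Nat.not_even_iff_odd.mp h).neg_one_pow, map_add, map_add]
    ring

end AlmostSymmetricMED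

/-! ### The multiset identity and the cardinalities. -/

section SyzygyDegrees

open LaurentPolynomial

variable {k : Type*} [Field k] {m : ℕ} {d : Fin m → ℕ}

theorem sum_filter_odd_add_sum_filter_even {M : Type*} [AddCommMonoid M] (s : Finset ℕ)
    (f : ℕ → M) : ∑ i ∈ s.filter (fun i => Odd i), f i + ∑ i ∈ s.filter (fun i => Even i), f i =
      ∑ i ∈ s, f i := by
  rw [← Finset.sum_filter_add_sum_filter_not s (fun i => Odd i)]
  simp only [Nat.not_odd_iff_even]

theorem card_multX (P : MinimalResolution k d (semigroupIdeal k d)) :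
    P.multX₁.card + P.multX₂.card = 2 * ∑ i ∈ Finset.Ico 1 (m - 1), (P.multB i).card := by
  have h1 : P.multX₁ + P.multX₂ = P.multBo + P.multBe + (P.multBoBar + P.multBeBar) := by
    rw [MinimalResolution.multX₁, MinimalResolution.multX₂]
    split_ifs <;> abel
  rw [← Multiset.card_add, h1, MinimalResolution.multBo, MinimalResolution.multBe,
    MinimalResolution.multBoBar, MinimalResolution.multBeBar,
    sum_filter_odd_add_sum_filter_even, sum_filter_odd_add_sum_filter_even,
    Multiset.card_add, Multiset.card_sum, Multiset.card_sum, two_mul]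
  simp only [MinimalResolution.multBbar, Multiset.card_map]

variable [NeZero m]

theorem exists_ne_zero_forall_le (h2 : 2 ≤ m) : ∃ l : Fin m, l ≠ 0 ∧ ∀ i, i ≤ l := by
  refine ⟨⟨m - 1, by omega⟩, fun h => ?_, fun i => ?_⟩
  · have := congrArg Fin.val h
    simp only [Fin.val_zero] at this
    omega
  · have := i.2
    simp only [Fin.le_def]
    omega

/-- The identity of multisets behind the equality of the intersection cardinalities. -/
theorem multX_add_multM (hd : IsMinimalGenerators d) (hm : d 0 = m) (h2 : 2 ≤ m)
    (hAS : IsAlmostSymmetric (semigroup d)) (P : MinimalResolution k d (semigroupIdeal k d)) :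
    P.multX₁ + multM₁ d = P.multX₂ + multM₂ d := by
  obtain ⟨l, hl, hmax⟩ := exists_ne_zero_forall_le h2
  have hF := hd.frobenius_eq hm hl hmax
  have hΔ := hd.gapsHFinset_val hm hAS hl hmax
  have hinv := invert_genFun_gapsHFinset hd
  have hX := genFun_multX₂_sub P
  have hM := genFun_multM₂_sub (d := d)
  have hsum := Finset.add_sum_erase _ (fun j => (d j : ℤ)) (Finset.mem_univ (0 : Fin m))
  rw [hm] at hsum
  have hE := invert_prod_one_sub (Finset.univ.erase (0 : Fin m)) fun j => (d j : ℤ)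
  rw [card_univ_erase_zero] at hE
  -- Almost symmetry enters here: Δ_H consists of the d i - m with i different from 0 and l, so only
  -- T^(d l) is left over.
  have hw : genFun (tailSums d 1) = T (m : ℤ) * genFun (gapsHFinset (semigroup d)).val +
      T (d l : ℤ) := by
    rw [tailSums_one, hΔ, genFun_map_val, genFun_map_val, Finset.mul_sum,
      ← Finset.sum_erase_add _ _ (Finset.mem_erase.mpr ⟨hl, Finset.mem_univ l⟩)]
    congr 1
    refine Finset.sum_congr rfl fun j _ => ?_
    rw [← T_add]
    congr 1
    ring
  have hfs : frobenius (semigroup d) + ∑ j, (d j : ℤ) =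
      d l + ∑ j ∈ Finset.univ.erase (0 : Fin m), (d j : ℤ) := by
    rw [hF, ← hsum]
    ring
  rw [sum_genFun_multB hd hm h2 P, hfs, hw] at hX
  rw [sum_genFun_genSums hm] at hM
  rw [hF] at hinv
  simp only [map_add, map_sub, map_mul, map_pow, map_neg, map_one, hE, invert_T] at hX
  set s' := ∑ j ∈ Finset.univ.erase (0 : Fin m), (d j : ℤ)
  have hε : ((-1) ^ (m - 1) : ℤ[T;T⁻¹]) * (-1) ^ (m - 1) = 1 := by
    rw [← mul_pow]
    simp
  have hUV : (T (d l : ℤ) : ℤ[T;T⁻¹]) * T (-(d l : ℤ)) = 1 := by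
    rw [← T_add, add_neg_cancel, T_zero]
  have hsz : (T s' : ℤ[T;T⁻¹]) * T (-s') = 1 := by
    rw [← T_add, add_neg_cancel, T_zero]
  -- The symmetry h ↦ F - h of Δ_H with F = d l - m. It turns the inverted w into T^(-d l) (D + 1).
  have hV : T (-(m : ℤ)) * invert (genFun (gapsHFinset (semigroup d)).val) =
      T (-(d l : ℤ)) * genFun (gapsHFinset (semigroup d)).val := by
    conv_rhs => rw [← hinv, ← mul_assoc, ← T_add]
    congr 2
    ring
  apply genFun_injective
  rw [map_add, map_add]
  rw [hV, T_add] at hX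
  generalize genFun (gapsHFinset (semigroup d)).val = D at *
  generalize ∏ j ∈ Finset.univ.erase (0 : Fin m), (1 - T (d j : ℤ) : ℤ[T;T⁻¹]) = E at *
  generalize ((-1) ^ (m - 1) : ℤ[T;T⁻¹]) = ε at *
  -- What remains is polynomial algebra modulo ε² = 1 and the invertibility of T^(d l) and T^(s').
  linear_combination -hX - hM +
    (E * (D + 1) + T (d l : ℤ) * E - (D + 1)) * hε +
    ε * ε * (E - 1) * (D + 1) * (T s' * T (-s') * hUV + hsz) + ε * ε * T (d l : ℤ) * E * hsz

/-- Taking cardinalities in `multB_add_tailSums` gives |B_i| = (m-1) C(m-1, i) - C(m-1, i+1).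
Summing over 1 ≤ i ≤ m - 2 needs the row sum of binomial coefficients, truncated at both ends in the
first term and to the indices from 2 on in the second. -/
theorem sum_card_multB (hd : IsMinimalGenerators d) (hm : d 0 = m) (h2 : 2 ≤ m)
    (P : MinimalResolution k d (semigroupIdeal k d)) :
    2 * ∑ i ∈ Finset.Ico 1 (m - 1), (P.multB i).card = (2 ^ m - 2) * (m - 2) := by
  have hcard : ∀ i ∈ Finset.Ico 1 (m - 1), (P.multB i).card + (m - 1).choose (i + 1) =
      (m - 1).choose i * (m - 1) := by
    intro i hi
    obtain ⟨j, rfl⟩ := Nat.exists_eq_add_of_le' (Finset.mem_Ico.mp hi).1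
    have h := congrArg Multiset.card (multB_add_tailSums hd hm P j)
    simpa only [Multiset.card_add, joinSumset, Multiset.card_map, Multiset.card_product, tailSums,
      Finset.card_val, Finset.card_powersetCard, card_univ_erase_zero, Nat.choose_one_right] using h
  have h := Finset.sum_congr rfl hcard
  rw [Finset.sum_add_distrib, ← Finset.sum_mul] at h
  obtain ⟨q, rfl⟩ := Nat.exists_eq_add_of_le' h2
  simp only [Nat.add_sub_cancel, show q + 2 - 1 = q + 1 from rfl] at h ⊢
  have e1 := Nat.sum_range_choose (q + 1)
  have e2 := e1
  rw [Finset.sum_range_succ, Finset.range_eq_Ico, Finset.sum_eq_sum_Ico_succ_bot (by omega)] at e1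
  rw [Finset.sum_range_succ', Finset.range_eq_Ico, Finset.sum_eq_sum_Ico_succ_bot (by omega)] at e2
  simp only [Nat.choose_zero_right, Nat.choose_self, zero_add, Nat.choose_one_right] at e1 e2
  have e3 : ∑ i ∈ Finset.Ico 1 (q + 1), (q + 1).choose i = 2 ^ (q + 1) - 2 := by omega
  have e4 : 2 ^ (q + 2) = 2 * 2 ^ (q + 1) := by ring
  have e5 : 2 ≤ 2 ^ (q + 1) := by
    rw [pow_succ]
    have := Nat.one_le_two_pow (n := q)
    omega
  rw [e3] at h
  rw [e4]
  obtain ⟨N, hN⟩ := Nat.exists_eq_add_of_le' e5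
  rw [hN] at h e2 ⊢
  have e6 : 2 * (N + 2) - 2 = 2 * N + 2 := by omega
  rw [e6]
  rw [Nat.add_sub_cancel] at h
  linarith

/-- Here |Δ_H| = m - 2, so |L_i| = C(m, i) (m - 2), and the binomial row without its two ends sums
to 2^m - 2. -/
theorem card_multM (hd : IsMinimalGenerators d) (hm : d 0 = m) (h2 : 2 ≤ m)
    (hAS : IsAlmostSymmetric (semigroup d)) :
    (multM₁ d).card + (multM₂ d).card = (2 ^ m - 2) * (m - 2) := by
  obtain ⟨l, hl, hmax⟩ := exists_ne_zero_forall_le h2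
  have hL : ∀ i, (multL d i).card = m.choose i * (m - 2) := by
    intro i
    rw [multL, joinSumset, Multiset.card_map, Multiset.card_product,
      hd.gapsHFinset_val hm hAS hl hmax, genSums, Multiset.card_map, Multiset.card_map,
      Finset.card_val, Finset.card_val, Finset.card_powersetCard, Finset.card_univ,
      Fintype.card_fin, Finset.card_erase_of_mem (Finset.mem_erase.mpr ⟨hl, Finset.mem_univ l⟩),
      card_univ_erase_zero]
    rfl
  rw [← Multiset.card_add, multM₁, multM₂, sum_filter_odd_add_sum_filter_even, Multiset.card_sum,
    Finset.sum_congr rfl fun i _ => hL i, ← Finset.sum_mul]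
  have e := Nat.sum_range_choose m
  rw [sum_range_eq_add_sum_Ico (by omega : 2 ≤ m + 1), Nat.add_sub_cancel, Nat.choose_zero_right,
    Nat.choose_self] at e
  congr 1
  omega

end SyzygyDegrees

end NumSemigroup

theorem theorem8 {k : Type*} [Field k] [CharZero k] {m : ℕ} [NeZero m] (d : Fin m → ℕ)
    (hd : NumSemigroup.IsMinimalGenerators d)
    (hMED : d 0 = m)
    (hAS : NumSemigroup.IsAlmostSymmetric (NumSemigroup.semigroup d))
    (P : NumSemigroup.MinimalResolution k d (NumSemigroup.semigroupIdeal k d)) :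
    P.rho = NumSemigroup.ell d := by
  -- For m = 1 there is no second generator, but every index range is empty and both cardinalities
  -- are 0.
  rcases (NeZero.one_le (n := m)).eq_or_lt with h | h
  · subst h
    simp [NumSemigroup.MinimalResolution.rho, NumSemigroup.ell,
      NumSemigroup.MinimalResolution.multX₁, NumSemigroup.MinimalResolution.multX₂,
      NumSemigroup.MinimalResolution.multBo, NumSemigroup.MinimalResolution.multBe,
      NumSemigroup.MinimalResolution.multBoBar, NumSemigroup.MinimalResolution.multBeBar,
      NumSemigroup.multM₁, NumSemigroup.multM₂]
  · refine NumSemigroup.card_inter_eq_card_inter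
      (NumSemigroup.multX_add_multM hd hMED h hAS P) ?_
    rw [NumSemigroup.card_multX, NumSemigroup.sum_card_multB hd hMED h P,
      NumSemigroup.card_multM hd hMED h hAS]
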